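/- Let $\Gamma$ be a finite undirected graph with vertex set $\mathcal G$ (adjacency is written $i\sim j$), let $\Lambda\subset\mathcal G$, and let $U_j,V_{ij},\kappa_m:\mathbb R\to\mathbb R$ ($j\in\mathcal G$, $i\sim j$, $m\in\Lambda$) with $V_{ij}(x)=V_{ji}(-x)$. Consider $$\ddot q_j=-U_j'(q_j)+\sum_{i\sim j}V_{ij}'(q_i-q_j)+\delta_{j\Lambda}\int_{\mathbb R}\kappa_j(\nu)\xi_j(\nu)\,d\nu,\qquad \ddot\xi_m(\nu)=-\nu^2\xi_m(\nu)+\kappa_m(\nu)q_m,\qquad j\in\mathcal G,\ m\in\Lambda,\ \nu\in\mathbb R,\tag{1}$$ with initial conditions $(q,\xi,\dot q,\dot\xi)(0)=(q_0,\xi_0,\dot q_0,\dot\xi_0)$, where $\delta_{j\Lambda}=1$ if $j\in\Lambda$ and $0$ otherwise. Put $$K_m=\int_{\mathbb R}\frac{\kappa_m^2}{\nu^2}\,d\nu,\qquad V^{\rm eff}(q)=\sum_jU_j(q_j)+\tfrac12\sum_{i\sim j}V_{ij}(q_i-q_j)-\sum_{m\in\Lambda}\frac{K_mq_m^2}{2},\qquad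 \mathcal E_m=\tfrac12\int_{\mathbb R}\big(\dot\xi_m^2+\nu^2\xi_m^2\big)\,d\nu,$$ $$E=\sum_j\Big(\frac{\dot q_j^2}{2}+U_j(q_j)\Big)+\tfrac12\sum_{i\sim j}V_{ij}(q_i-q_j)+\sum_{m\in\Lambda}\mathcal E_m-\sum_{m\in\Lambda}q_m\int_{\mathbb R}\kappa_m\xi_m\,d\nu,$$ the sums $\tfrac12\sum_{i\sim j}$ being over ordered pairs. Assume: A1. All $U_j,V_{ij}$ are $C^\infty$, and each $V_{ij}''$ has only isolated zeros. A2. Each $\kappa_m$ is $C^2$, $\kappa_m(\nu)=0$ if and only if $\nu=0$, $\kappa_m,\kappa_m''\in L^1\cap L^2$, and $r\ge0$ is an integer such that $\nu^r\kappa_m\in L^2$ and $|\nu|^{r/2}\kappa_m'\in L^2$ for all $m\in\Lambda$. A3. $V^{\rm eff}(q)\to+\infty$ as $|q|\to\infty$. A4. $\mathcal E_m(0)<\infty$ for all $m\in\Lambda$. A5. $\Lambda_\Gamma=\mathcal G$, where $\Lambda_\Gamma$ is obtained from $\Lambda$ by repeatedly adding all vertices $n$ outside the current set $S$ such that $n$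 is the only neighbour outside $S$ of some $j\in S$. A6. The critical points of $V^{\rm eff}$ are isolated. Let $(q(t),\xi(\nu,t))$, $t\in\mathbb R$, be a solution of (1) with the given initial conditions. Then $\mathcal E_m(t)<\infty$ for all $t\in\mathbb R$ and $m\in\Lambda$, there are critical points $q_c^+,q_c^-$ of $V^{\rm eff}$ with $q(t)\to q_c^\pm$ as $t\to\pm\infty$, and $$\sum_{m\in\Lambda}\mathcal E_m(t)\to E(q_0,\xi_0,\dot q_0,\dot\xi_0)-V^{\rm eff}(q_c^\pm)+\sum_{m\in\Lambda}\frac{K_m\big((q_c^\pm)_m\big)^2}{2}\qquad\text{as }t\to\pm\infty.$$ Moreover, for every $m\in\Lambda$ the function $\mathcal E_m$ is $C^{r+1}$, and $\frac{d^l}{dt^l}\mathcal E_m(t)\to0$ as $t\to\pm\infty$ for all $1\le l\le r+1$. -/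

import Mathlib

open MeasureTheory Filter Topology
open scoped ContDiff

noncomputable section

/-- The data of the model: a finite graph of one-dimensional oscillators with on-site potentials
`U j` and interaction potentials `V i j`, together with a set `thermo` (written `Λ`) of vertices,
each coupled to its own thermostat with coupling function `κ m`.  The values of `V i j` for
non-adjacent `i, j` and of `κ m` for `m ∉ Λ` are never used. -/
structure OscillatorNetwork (G : Type*) where
  graph : SimpleGraph G
  thermo : Finset G
  U : G → ℝ → ℝ
  V : G → G → ℝ → ℝ
  κ : G → ℝ → ℝ
  V_symm : ∀ i j, graph.Adj i j → ∀ x, V i j x = V j i (-x)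

namespace OscillatorNetwork

variable {G : Type*} [Fintype G]

/-- `K_m = ∫ κ_m(ν)² / ν² dν`. -/
def K (N : OscillatorNetwork G) (m : G) : ℝ := ∫ ν : ℝ, (N.κ m ν) ^ 2 / ν ^ 2

open Classical in
/-- The potential energy of the oscillators,
`∑ U_j(q_j) + (1/2) ∑_{i ∼ j} V_ij(q_i - q_j)`, the last sum being over ordered pairs. -/
def potential (N : OscillatorNetwork G) (q : G → ℝ) : ℝ :=
  ∑ j, N.U j (q j)
    + (1 / 2) * ∑ i, ∑ j, if N.graph.Adj i j then N.V i j (q i - q j) else 0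

/-- The effective potential. -/
def Veff (N : OscillatorNetwork G) (q : G → ℝ) : ℝ :=
  N.potential q - ∑ m ∈ N.thermo, N.K m * (q m) ^ 2 / 2

/-- The critical points of the effective potential: all partial derivatives vanish. -/
def critSet (N : OscillatorNetwork G) : Set (G → ℝ) :=
  letI := Classical.decEq G
  {q | ∀ j, fderiv ℝ N.Veff q (Pi.single j 1) = 0}

end OscillatorNetwork

/-- The energy `(1/2) ∫ (η² + ν² ξ²) dν` of a thermostat in the state with coordinates `ξ(ν)` and
velocities `η(ν)`. -/
def thermostatEnergy (ξ η : ℝ → ℝ) : ℝ := (1 / 2) * ∫ ν : ℝ, ((η ν) ^ 2 + ν ^ 2 * (ξ ν) ^ 2)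

/-- A (measurable) thermostat state has finite energy. -/
def FiniteThermostatEnergy (ξ η : ℝ → ℝ) : Prop :=
  AEStronglyMeasurable ξ volume ∧ AEStronglyMeasurable η volume ∧
    Integrable (fun ν : ℝ => (η ν) ^ 2 + ν ^ 2 * (ξ ν) ^ 2) volume

namespace OscillatorNetwork

variable {G : Type*} [Fintype G]

/-- The total energy of a state with oscillator coordinates `q`, oscillator velocities `v`,
thermostat coordinates `ξ` and thermostat velocities `η`. -/
def totalEnergy (N : OscillatorNetwork G) (q v : G → ℝ) (ξ η : G → ℝ → ℝ) : ℝ :=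
  ∑ j, (v j) ^ 2 / 2 + N.potential q
    + ∑ m ∈ N.thermo, thermostatEnergy (ξ m) (η m)
    - ∑ m ∈ N.thermo, q m * ∫ ν : ℝ, N.κ m ν * ξ m ν

open Classical in
/-- `(q, v, ξ, η)` is a solution, defined for all `t ∈ ℝ`, of the equations of motion
`q̈_j = -U_j'(q_j) + ∑_{i ∼ j} V_ij'(q_i - q_j) + δ_{jΛ} ∫ κ_j ξ_j dν`,
`ξ̈_m(ν) = -ν² ξ_m(ν) + κ_m(ν) q_m` (`m ∈ Λ`, almost every `ν`),
with `v = q̇`, `η = ξ̇`, and with initial values `(q₀, v₀, ξ₀, η₀)`.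
The arguments are ordered as `q j t` and `ξ m t ν`. -/
structure IsSolution (N : OscillatorNetwork G) (q₀ v₀ : G → ℝ) (ξ₀ η₀ : G → ℝ → ℝ)
    (q v : G → ℝ → ℝ) (ξ η : G → ℝ → ℝ → ℝ) : Prop where
  q_init : ∀ j, q j 0 = q₀ j
  v_init : ∀ j, v j 0 = v₀ j
  ξ_init : ∀ m ∈ N.thermo, ∀ᵐ ν : ℝ, ξ m 0 ν = ξ₀ m ν
  η_init : ∀ m ∈ N.thermo, ∀ᵐ ν : ℝ, η m 0 ν = η₀ m ν
  q_deriv : ∀ j t, HasDerivAt (q j) (v j t) t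
  integrable : ∀ m ∈ N.thermo, ∀ t, Integrable (fun ν : ℝ => N.κ m ν * ξ m t ν) volume
  v_deriv : ∀ j t, HasDerivAt (v j)
    (-deriv (N.U j) (q j t)
      + (∑ i, if N.graph.Adj i j then deriv (N.V i j) (q i t - q j t) else 0)
      + (if j ∈ N.thermo then ∫ ν : ℝ, N.κ j ν * ξ j t ν else 0)) t
  ξ_deriv : ∀ m ∈ N.thermo, ∀ᵐ ν : ℝ, ∀ t, HasDerivAt (fun s => ξ m s ν) (η m t ν) t
  η_deriv : ∀ m ∈ N.thermo, ∀ᵐ ν : ℝ, ∀ t,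
    HasDerivAt (fun s => η m s ν) (-ν ^ 2 * ξ m t ν + N.κ m ν * q m t) t

/-- Assumption A1: smooth potentials, and `V_ij''` has only isolated zeros. -/
def A1 (N : OscillatorNetwork G) : Prop :=
  (∀ j, ContDiff ℝ ∞ (N.U j)) ∧
  ∀ i j, N.graph.Adj i j → ContDiff ℝ ∞ (N.V i j) ∧
    ∀ x, deriv (deriv (N.V i j)) x = 0 → ∀ᶠ y in 𝓝[≠] x, deriv (deriv (N.V i j)) y ≠ 0

/-- Assumption A2 with the integer `r`. -/
def A2 (N : OscillatorNetwork G) (r : ℕ) : Prop :=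
  ∀ m ∈ N.thermo, ContDiff ℝ 2 (N.κ m) ∧ (∀ ν, N.κ m ν = 0 ↔ ν = 0) ∧
    MemLp (N.κ m) 1 volume ∧ MemLp (N.κ m) 2 volume ∧
    MemLp (deriv (deriv (N.κ m))) 1 volume ∧ MemLp (deriv (deriv (N.κ m))) 2 volume ∧
    MemLp (fun ν : ℝ => ν ^ r * N.κ m ν) 2 volume ∧
    MemLp (fun ν : ℝ => |ν| ^ ((r : ℝ) / 2) * deriv (N.κ m) ν) 2 volume

/-- Assumption A3: the effective potential is coercive. -/
def A3 (N : OscillatorNetwork G) : Prop :=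
  Tendsto N.Veff (cocompact (G → ℝ)) atTop

/-- Assumption A4: the initial thermostat energies are finite. -/
def A4 (N : OscillatorNetwork G) (ξ₀ η₀ : G → ℝ → ℝ) : Prop :=
  ∀ m ∈ N.thermo, FiniteThermostatEnergy (ξ₀ m) (η₀ m)

/-- One step of the control procedure: add to `S` every vertex `n ∉ S` which is the unique
neighbour outside `S` of some `j ∈ S`. -/
def controlStep (N : OscillatorNetwork G) (S : Set G) : Set G :=
  S ∪ {n | ∃ j ∈ S, n ∉ S ∧ N.graph.Adj j n ∧ ∀ i, N.graph.Adj j i → i ∉ S → i = n}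

/-- The set `Λ_Γ` obtained from `Λ` by iterating the control procedure. -/
def controlled (N : OscillatorNetwork G) : Set G :=
  ⋃ k : ℕ, (N.controlStep)^[k] (N.thermo : Set G)

/-- Assumption A5: the thermostats control the whole network. -/
def A5 (N : OscillatorNetwork G) : Prop := N.controlled = Set.univ

/-- Assumption A6: the critical points of the effective potential are isolated. -/
def A6 (N : OscillatorNetwork G) : Prop :=
  ∀ q ∈ N.critSet, ∀ᶠ q' in 𝓝[≠] q, q' ∉ N.critSet

end OscillatorNetwork

end

/-!
Each thermostat is a linear system, so it can be solved explicitly. With the form factor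
`f = κ / ν`, the complex amplitude `Z = η + i (ν ξ - f q)` satisfies `∂ₜ Z = iν Z - i f q̇`, that is,
`Z_t = e^{iνt} (Z_0 - i f ∫_0^t e^{-iνs} q̇(s) ds)` (`IsSolution.amplitude_eq_bathAmp`), and the
oscillators obey `q̈_j = -∂_j Veff(q) + Im ∫ f Z_j` (`IsSolution.isReducedSolution`), the last term
being present only at vertices with a thermostat. The total energy equals
`∑ q̇² / 2 + Veff(q) + ½ ∑ ‖Z‖²` (`IsReducedSolution.energy_eq`), so coercivity of `Veff` bounds
`q`, `q̇`, `q̈` and the `L²` norms of the amplitudes for all times.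

Relaxation of a vertex with a thermostat (`tendsto_zero_of_bathAmp_bounded`): the functions
`f ∫_{-T}^T e^{-iνs} q̇(s) ds` are bounded in `L²`; let `Φ` be a weak cluster point as `T → ∞`. If
`ψ = g f` with `g ∈ L²`, the average of `q̇` against the translate by `τ` of the Fourier transform
of `ψ` equals, up to a constant factor, `∫ g(ν) e^{iντ} Φ(ν) dν`, which tends to zero by the
Riemann–Lebesgue lemma (`tendsto_integral_mul_hat`). As `f` vanishes at most at the origin, `ψ` may
be any cutoff to frequencies between `e` and `a`. Frequencies above `a` contribute little to `q̇`
because `q̈` is bounded, and frequencies below `e` because `q` is bounded. Hence `q̇ → 0`.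
Consequently `Z → 0` weakly in `L²` (`tendsto_integral_mul_bathAmp`), so that all forces exerted by
the thermostats converge.

Relaxation of the other vertices (`IsReducedSolution.tendsto_v_of_mem_controlStep`): if `j` and all
its neighbours but `n` come to rest, Barbalat's lemma (`tendsto_zero_of_hasDerivAt_add`), applied
twice, shows that `V''(q_n - q_j) (q̇_n - q̇_j) → 0`; as the zeros of `V''` are isolated, `q̇_n → 0`
(`tendsto_zero_of_mul_tendsto_zero`). By the control condition every vertex comes to rest, and
Barbalat's lemma gives `∇Veff(q(t)) → 0`. A bounded curve with this property converges when the
critical points are isolated (`exists_tendsto_of_isolated_zeros`).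

The limit of the thermostat energies now follows from conservation of energy. The power transferred
to the thermostat at `m` is `q_m ∫ κ Re Z`. The time derivative of the moment `∫ ν^k κ Z` involves
only the next moment and the velocity; all moments with `k ≤ r` tend to zero, and a bootstrap
(`IsReducedSolution.convergesToOrder`) yields the derivatives of the thermostat energies. The
statement for `t → -∞` follows by time reversal.
-/

/-! ### Baths of oscillators driven by a motion -/

/-- The phase factor `e^{ix}`. -/
noncomputable def phase (x : ℝ) : ℂ := Complex.exp (x * Complex.I)

lemma norm_phase (x : ℝ) : ‖phase x‖ = 1 := Complex.norm_exp_ofReal_mul_I x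

lemma phase_add (x y : ℝ) : phase (x + y) = phase x * phase y := by
  simp [phase, add_mul, Complex.exp_add]

@[simp] lemma phase_zero : phase 0 = 1 := by simp [phase]

@[fun_prop] lemma continuous_phase : Continuous phase := by unfold phase; fun_prop

lemma hasDerivAt_phase (ν t : ℝ) :
    HasDerivAt (fun t : ℝ => phase (ν * t)) (Complex.I * ν * phase (ν * t)) t := by
  have h : HasDerivAt (fun t : ℝ => ((ν * t : ℝ) : ℂ) * Complex.I) ((ν * 1 : ℝ) * Complex.I) t :=
    (((hasDerivAt_id t).const_mul ν).ofReal_comp).mul_const _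
  have := h.cexp
  unfold phase
  convert this using 1
  push_cast; ring

/-- The Fourier integral `∫_a^b e^{-iνs} v(s) ds` of the motion `v` over a finite time interval. -/
noncomputable def drive (v : ℝ → ℝ) (a b ν : ℝ) : ℂ := ∫ s in a..b, phase (-(ν * s)) * v s

/-- The complex amplitude at time `t` of a bath of oscillators with frequencies `ν`, driven through
the form factor `f` by the motion `v`: the solution of `∂ₜ Z = iν Z - i f v` with `Z = z` at
`t = 0`. -/
noncomputable def bathAmp (f : ℝ → ℝ) (z : ℝ → ℂ) (v : ℝ → ℝ) (t ν : ℝ) : ℂ :=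
  phase (ν * t) * (z ν - Complex.I * f ν * drive v 0 t ν)

section drive

variable {v : ℝ → ℝ}

lemma continuous_drive (hv : Continuous v) (a b : ℝ) : Continuous (drive v a b) := by
  unfold drive
  apply intervalIntegral.continuous_parametric_intervalIntegral_of_continuous'
  simp only [Function.uncurry_def]
  fun_prop

lemma hasDerivAt_drive (hv : Continuous v) (ν t : ℝ) :
    HasDerivAt (fun t => drive v 0 t ν) (phase (-(ν * t)) * v t) t := by
  have hc : Continuous (fun s : ℝ => phase (-(ν * s)) * v s) := by fun_prop
  exact hc.integral_hasStrictDerivAt 0 t |>.hasDerivAt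

lemma norm_drive_le {C : ℝ} {a b : ℝ} (hC : ∀ s ∈ Set.uIoc a b, |v s| ≤ C) (ν : ℝ) :
    ‖drive v a b ν‖ ≤ C * |b - a| := by
  refine intervalIntegral.norm_integral_le_of_norm_le_const fun s hs => ?_
  simpa [norm_phase] using hC s hs

lemma drive_sub (hv : Continuous v) (a b ν : ℝ) :
    drive v 0 b ν - drive v 0 a ν = drive v a b ν := by
  have hc : Continuous (fun s : ℝ => phase (-(ν * s)) * v s) := by fun_prop
  exact intervalIntegral.integral_interval_sub_left (hc.intervalIntegrable _ _)
    (hc.intervalIntegrable _ _)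

lemma exists_drive_bound (hv : Continuous v) (T : ℝ) :
    ∃ B, 0 ≤ B ∧ ∀ t, |t| ≤ T → |v t| ≤ B ∧ ∀ ν, ‖drive v 0 t ν‖ ≤ B := by
  obtain ⟨C, hC⟩ := isCompact_Icc (a := -T) (b := T) |>.exists_bound_of_continuousOn hv.continuousOn
  have hC' : ∀ s, |s| ≤ T → |v s| ≤ C := fun s hs => hC s (abs_le.mp hs)
  rcases lt_or_ge T 0 with hT | hT
  · exact ⟨0, le_rfl, fun t ht => absurd ((abs_nonneg t).trans ht) (not_le.mpr hT)⟩
  have hC0 : 0 ≤ C := (abs_nonneg _).trans (hC' 0 (by simpa using hT))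
  refine ⟨C * (1 + T), by positivity, fun t ht => ⟨(hC' t ht).trans ?_, fun ν => ?_⟩⟩
  · nlinarith
  · refine (norm_drive_le (C := C) (fun s hs => hC' s ?_) ν).trans ?_
    · have h0 := abs_le.mp ht
      rcases Set.mem_uIoc.mp hs with h | h <;> rw [abs_le] <;> constructor <;> linarith [h.1, h.2]
    · rw [sub_zero]; nlinarith [abs_nonneg t]

end drive

section bathAmp

variable {f : ℝ → ℝ} {z : ℝ → ℂ} {v : ℝ → ℝ}

lemma bathAmp_zero : bathAmp f z v 0 = z := by
  ext ν; simp [bathAmp, drive]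

lemma hasDerivAt_bathAmp (hv : Continuous v) (ν t : ℝ) :
    HasDerivAt (fun t => bathAmp f z v t ν)
      (Complex.I * ν * bathAmp f z v t ν - Complex.I * f ν * v t) t := by
  have h := (hasDerivAt_phase ν t).mul
    (((hasDerivAt_drive hv ν t).const_mul (Complex.I * f ν)).const_sub (z ν))
  have e : phase (ν * t) * phase (-(ν * t)) = 1 := by rw [← phase_add]; simp
  unfold bathAmp
  refine h.congr_deriv ?_
  linear_combination (-Complex.I * f ν * v t) * e

lemma norm_bathAmp_le {B : ℝ} {t ν : ℝ} (hB : ‖drive v 0 t ν‖ ≤ B) :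
    ‖bathAmp f z v t ν‖ ≤ ‖z ν‖ + B * |f ν| := by
  rw [bathAmp, norm_mul, norm_phase, one_mul]
  refine (norm_sub_le _ _).trans ?_
  gcongr
  simp only [norm_mul, Complex.norm_I, one_mul, Complex.norm_real, Real.norm_eq_abs]
  rw [mul_comm]
  gcongr

lemma aestronglyMeasurable_bathAmp (hf : MemLp f 2) (hz : MemLp z 2) (hv : Continuous v) (t : ℝ) :
    AEStronglyMeasurable (bathAmp f z v t) volume := by
  have h1 : AEStronglyMeasurable (fun ν => (f ν : ℂ)) volume :=
    Complex.continuous_ofReal.comp_aestronglyMeasurable hf.1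
  have h2 := (continuous_drive hv 0 t).aestronglyMeasurable (μ := volume)
  have h3 : AEStronglyMeasurable (fun ν : ℝ => phase (ν * t)) volume :=
    (by fun_prop : Continuous fun ν : ℝ => phase (ν * t)).aestronglyMeasurable
  exact h3.mul (hz.1.sub ((h1.const_mul Complex.I).mul h2))

lemma memLp_bathAmp (hf : MemLp f 2) (hz : MemLp z 2) (hv : Continuous v) (t : ℝ) :
    MemLp (bathAmp f z v t) 2 := by
  obtain ⟨B, -, hB⟩ := exists_drive_bound hv |t|
  refine (hz.norm.add (hf.norm.const_mul B)).mono (aestronglyMeasurable_bathAmp hf hz hv t)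
    (Eventually.of_forall fun ν => ?_)
  refine (norm_bathAmp_le ((hB t le_rfl).2 ν)).trans ?_
  exact le_abs_self _

/-- Observables `∫ g Z` of the bath are differentiable in time, and the derivative may be taken
under the integral. -/
lemma hasDerivAt_integral_bathAmp (hf : MemLp f 2) (hz : MemLp z 2) (hv : Continuous v)
    {g : ℝ → ℝ} (hg : MemLp g 2) (hg' : MemLp (fun ν => ν * g ν) 2) (t : ℝ) :
    HasDerivAt (fun t => ∫ ν, (g ν : ℂ) * bathAmp f z v t ν)
      (Complex.I * (∫ ν, ((ν * g ν : ℝ) : ℂ) * bathAmp f z v t ν)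
        - Complex.I * v t * ((∫ ν, f ν * g ν : ℝ) : ℂ)) t := by
  have hgC : MemLp (fun ν => (g ν : ℂ)) 2 := hg.ofReal
  have hgC' : MemLp (fun ν => ((ν * g ν : ℝ) : ℂ)) 2 := hg'.ofReal
  obtain ⟨B, hB0, hB⟩ := exists_drive_bound hv (|t| + 1)
  have hball : ∀ s ∈ Metric.ball t 1, |s| ≤ |t| + 1 := fun s hs => by
    have := Metric.mem_ball.mp hs
    rw [Real.dist_eq] at this
    have h2 := abs_add_le (s - t) t
    simp only [sub_add_cancel] at h2
    linarith
  have hfg : Integrable (fun ν => f ν * g ν) := hf.integrable_mul hg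
  have key := (hasDerivAt_integral_of_dominated_loc_of_deriv_le
    (F := fun t ν => (g ν : ℂ) * bathAmp f z v t ν)
    (F' := fun t ν => (g ν : ℂ) * (Complex.I * ν * bathAmp f z v t ν - Complex.I * f ν * v t))
    (bound := fun ν => |ν * g ν| * (‖z ν‖ + B * |f ν|) + B * |f ν * g ν|)
    (μ := volume) (x₀ := t) (Metric.ball_mem_nhds t one_pos)
    (Eventually.of_forall fun s => hgC.1.mul (aestronglyMeasurable_bathAmp hf hz hv s))
    (hgC.integrable_mul (memLp_bathAmp hf hz hv t)) ?_ ?_ ?_ ?_).2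
  · refine key.congr_deriv ?_
    have h1 : Integrable (fun ν => ((ν * g ν : ℝ) : ℂ) * bathAmp f z v t ν) :=
      hgC'.integrable_mul (memLp_bathAmp hf hz hv t)
    rw [← integral_complex_ofReal, ← integral_const_mul, ← integral_const_mul, ← integral_sub]
    · congr 1 with ν
      push_cast; ring
    · exact h1.const_mul _
    · exact hfg.ofReal.const_mul _
  · have h1 : AEStronglyMeasurable (fun ν => (f ν : ℂ)) volume := hf.ofReal.1
    have h4 : AEStronglyMeasurable (fun ν : ℝ => Complex.I * (ν : ℂ)) volume :=
      (by fun_prop : Continuous fun ν : ℝ => Complex.I * (ν : ℂ)).aestronglyMeasurable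
    exact hgC.1.mul ((h4.mul (aestronglyMeasurable_bathAmp hf hz hv t)).sub
      ((h1.const_mul Complex.I).mul_const _))
  · refine Eventually.of_forall fun ν s hs => ?_
    obtain ⟨hb1, hb2⟩ := hB s (hball s hs)
    rw [mul_sub]
    refine (norm_sub_le _ _).trans (add_le_add ?_ ?_)
    · simp only [norm_mul, Complex.norm_I, one_mul, Complex.norm_real, Real.norm_eq_abs, abs_mul]
      rw [← mul_assoc, mul_comm |g ν|]
      gcongr
      exact norm_bathAmp_le (hb2 ν)
    · simp only [norm_mul, Complex.norm_I, one_mul, Complex.norm_real, Real.norm_eq_abs, abs_mul]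
      calc |g ν| * (|f ν| * |v s|) = |v s| * (|f ν| * |g ν|) := by ring
        _ ≤ _ := by gcongr
  · have h1 : Integrable (fun ν => |ν * g ν| * (‖z ν‖ + B * |f ν|)) :=
      hg'.norm.integrable_mul (hz.norm.add (hf.norm.const_mul B))
    exact h1.add (hfg.abs.const_mul B)
  · exact Eventually.of_forall fun ν s _ => (hasDerivAt_bathAmp hv ν s).const_mul _

/-- The bath exchanges energy with the motion at the rate `-v ∫ f Im Z`. -/
lemma hasDerivAt_integral_normSq_bathAmp (hf : MemLp f 2) (hz : MemLp z 2) (hv : Continuous v)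
    (t : ℝ) :
    HasDerivAt (fun t => ∫ ν, ‖bathAmp f z v t ν‖ ^ 2)
      (-2 * v t * (∫ ν, (f ν : ℂ) * bathAmp f z v t ν).im) t := by
  obtain ⟨B, hB0, hB⟩ := exists_drive_bound hv (|t| + 1)
  have hball : ∀ s ∈ Metric.ball t 1, |s| ≤ |t| + 1 := fun s hs => by
    have := Metric.mem_ball.mp hs
    rw [Real.dist_eq] at this
    have h2 := abs_add_le (s - t) t
    simp only [sub_add_cancel] at h2
    linarith
  have him : ∀ s, Integrable fun ν => (f ν : ℂ) * bathAmp f z v s ν := fun s =>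
    hf.ofReal.integrable_mul (memLp_bathAmp hf hz hv s)
  have key := (hasDerivAt_integral_of_dominated_loc_of_deriv_le
    (F := fun t ν => ‖bathAmp f z v t ν‖ ^ 2)
    (F' := fun t ν => -2 * v t * ((f ν : ℂ) * bathAmp f z v t ν).im)
    (bound := fun ν => 2 * B * (|f ν| * (‖z ν‖ + B * |f ν|)))
    (μ := volume) (x₀ := t) (Metric.ball_mem_nhds t one_pos)
    (Eventually.of_forall fun s => ((aestronglyMeasurable_bathAmp hf hz hv s).norm.pow 2))
    ((memLp_bathAmp hf hz hv t).integrable_norm_pow two_ne_zero) ?_ ?_ ?_ ?_).2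
  · refine key.congr_deriv ?_
    rw [integral_const_mul]
    congr 1
    exact (Complex.imCLM).integral_comp_comm (him t)
  · exact (Complex.continuous_im.comp_aestronglyMeasurable (him t).1).const_mul _
  · refine Eventually.of_forall fun ν s hs => ?_
    obtain ⟨hb1, hb2⟩ := hB s (hball s hs)
    have h1 : |((f ν : ℂ) * bathAmp f z v s ν).im| ≤ |f ν| * (‖z ν‖ + B * |f ν|) := by
      refine (Complex.abs_im_le_norm _).trans ?_
      simp only [norm_mul, Complex.norm_real, Real.norm_eq_abs]
      gcongr
      exact norm_bathAmp_le (hb2 ν)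
    rw [Real.norm_eq_abs, abs_mul, abs_mul, abs_neg, abs_two]
    gcongr
  · exact (hf.norm.integrable_mul (hz.norm.add (hf.norm.const_mul B))).const_mul _
  · refine Eventually.of_forall fun ν s _ => ?_
    have h := hasDerivAt_bathAmp (f := f) (z := z) hv ν s
    have h2 := h.norm_sq
    refine h2.congr_deriv ?_
    rw [Complex.inner]
    simp
    ring

end bathAmp

/-! ### Spectral content of a motion that leaves its bath bounded -/

/-- A bounded curve in a Hilbert space has a weak cluster point at `+∞`. -/
lemma exists_weak_clusterPt {H : Type*} [NormedAddCommGroup H] [InnerProductSpace ℂ H]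
    [CompleteSpace H] {y : ℝ → H} {M : ℝ} (hy : ∀ t, ‖y t‖ ≤ M) :
    ∃ w : H, ∀ (g : H) (c : ℂ), Tendsto (fun t => inner ℂ g (y t)) atTop (𝓝 c) →
      inner ℂ g w = c := by
  let φ : ℝ → WeakDual ℂ H := fun t => StrongDual.toWeakDual (InnerProductSpace.toDual ℂ H (y t))
  have hmem : ∀ t, φ t ∈ (WeakDual.toStrongDual (𝕜 := ℂ) (E := H)) ⁻¹' Metric.closedBall 0 M := by
    intro t
    simp only [Set.mem_preimage, mem_closedBall_zero_iff]
    exact ((InnerProductSpace.toDual ℂ H).norm_map (y t)).trans_le (hy t)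
  obtain ⟨w, -, hw⟩ := (WeakDual.isCompact_closedBall (0 : StrongDual ℂ H) M).exists_mapClusterPt
    (f := atTop) (u := φ) (tendsto_principal.mpr (Eventually.of_forall hmem))
  refine ⟨(InnerProductSpace.toDual ℂ H).symm (WeakDual.toStrongDual w), fun g c hc => ?_⟩
  have h1 : MapClusterPt (w g) atTop (fun t => φ t g) :=
    hw.continuousAt_comp (f := fun x : WeakDual ℂ H => x g) (WeakDual.eval_continuous g).continuousAt
  have h2 : Tendsto (fun t => φ t g) atTop (𝓝 (starRingEnd ℂ c)) := by
    have := (Complex.continuous_conj.tendsto c).comp hc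
    refine this.congr fun t => ?_
    exact inner_conj_symm _ _
  have h3 : w g = starRingEnd ℂ c := by
    have : ClusterPt (w g) (𝓝 (starRingEnd ℂ c)) := ClusterPt.mono h1 h2
    exact eq_of_nhds_neBot this
  rw [← inner_conj_symm, InnerProductSpace.toDual_symm_apply]
  have h4 : (WeakDual.toStrongDual w) g = w g := rfl
  rw [h4, h3, Complex.conj_conj]

lemma inner_toLp_toLp {g h : ℝ → ℂ} (hg : MemLp g 2) (hh : MemLp h 2) :
    inner ℂ (hg.toLp g) (hh.toLp h) = ∫ ν, h ν * starRingEnd ℂ (g ν) := by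
  rw [L2.inner_def]
  refine integral_congr_ae ?_
  filter_upwards [hg.coeFn_toLp, hh.coeFn_toLp] with ν h1 h2
  rw [h1, h2]; rfl

lemma norm_toLp_sq {g : ℝ → ℂ} (hg : MemLp g 2) : ‖hg.toLp g‖ ^ 2 = ∫ ν, ‖g ν‖ ^ 2 := by
  have h := inner_toLp_toLp hg hg
  rw [inner_self_eq_norm_sq_to_K] at h
  have h2 : ∀ ν, g ν * starRingEnd ℂ (g ν) = ((‖g ν‖ ^ 2 : ℝ) : ℂ) := fun ν => by
    rw [Complex.mul_conj, Complex.normSq_eq_norm_sq]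
  simp_rw [h2] at h
  rw [integral_complex_ofReal] at h
  apply Complex.ofReal_injective
  rw [← h]
  exact Complex.ofReal_pow _ _

/-- The Riemann–Lebesgue lemma in terms of `phase`. -/
lemma tendsto_integral_phase_mul (h : ℝ → ℂ) :
    Tendsto (fun τ : ℝ => ∫ ν, phase (ν * τ) * h ν) atTop (𝓝 0) := by
  have h1 := Real.tendsto_integral_exp_smul_cocompact h
  have h2 : Tendsto (fun τ : ℝ => -τ / (2 * Real.pi)) atTop (cocompact ℝ) := by
    refine Tendsto.mono_right ?_ atBot_le_cocompact
    exact tendsto_neg_atTop_atBot.atBot_div_const (by positivity)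
  refine (h1.comp h2).congr fun τ => ?_
  simp only [Function.comp]
  congr 1 with ν
  rw [Circle.smul_def, smul_eq_mul, Real.fourierChar_apply, phase]
  congr 3
  have := Real.pi_pos.ne'
  field_simp

/-- The Fourier transform in the normalization `∫ e^{-iνs} ψ(ν) dν`. -/
noncomputable def hat (ψ : ℝ → ℂ) (s : ℝ) : ℂ := ∫ ν, phase (-(ν * s)) * ψ ν

/-- Fubini's theorem turns an average of `drive` over frequencies into an average of the motion over
time. -/
lemma integral_mul_drive {ψ : ℝ → ℂ} (hψ : Integrable ψ) {v : ℝ → ℝ} (hv : Continuous v)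
    (a b τ : ℝ) :
    ∫ ν, phase (ν * τ) * ψ ν * drive v a b ν = ∫ s in a..b, v s * hat ψ (s - τ) := by
  have h1 : ∀ ν, phase (ν * τ) * ψ ν * drive v a b ν
      = ∫ s in a..b, v s * (phase (-(ν * (s - τ))) * ψ ν) := fun ν => by
    rw [drive, ← intervalIntegral.integral_const_mul]
    congr 1 with s
    have : -(ν * (s - τ)) = ν * τ + -(ν * s) := by ring
    rw [this, phase_add]; ring
  simp_rw [h1, hat, ← integral_const_mul]
  rw [intervalIntegral_integral_swap]
  obtain ⟨C, hC⟩ := isCompact_uIcc (a := a) (b := b) |>.exists_bound_of_continuousOn hv.continuousOn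
  have : IsFiniteMeasure (volume.restrict (Set.uIoc a b)) :=
    ⟨by rw [Measure.restrict_apply_univ]; simp [Set.uIoc]⟩
  have h2 : Integrable (fun p : ℝ × ℝ => C * ‖ψ p.2‖)
      ((volume.restrict (Set.uIoc a b)).prod volume) := (hψ.norm.comp_snd _).const_mul C
  refine h2.mono' ?_ ?_
  · have h3 : Continuous fun p : ℝ × ℝ => ((v p.1 : ℂ)) * phase (-(p.2 * (p.1 - τ))) := by fun_prop
    have h4 := h3.aestronglyMeasurable (μ := (volume.restrict (Set.uIoc a b)).prod volume)
    refine (h4.mul (hψ.1.comp_snd)).congr (Eventually.of_forall fun p => ?_)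
    simp only [Function.uncurry_def, Pi.mul_apply]; ring
  · have h5 : ∀ᵐ p : ℝ × ℝ ∂((volume.restrict (Set.uIoc a b)).prod volume), p.1 ∈ Set.uIoc a b :=
      Measure.quasiMeasurePreserving_fst.ae (ae_restrict_mem measurableSet_uIoc)
    filter_upwards [h5] with p hp
    simp only [Function.uncurry_def, norm_mul, norm_phase, one_mul, Complex.norm_real]
    gcongr
    exact hC _ (Set.uIoc_subset_uIcc hp)

section core

variable {f : ℝ → ℝ} {z : ℝ → ℂ} {v : ℝ → ℝ}

/-- If the amplitude of the bath stays bounded in `L²`, the motion `v` has, away from the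
frequencies where `f` vanishes, a square integrable spectrum, so that its averages against
`s ↦ ψ^(s - τ)` tend to zero whenever `ψ = g f` with `g ∈ L²`. -/
lemma tendsto_integral_mul_hat (hf : MemLp f 2) (hz : MemLp z 2) (hv : Continuous v)
    {M C : ℝ} (hM : ∀ t, ∫ ν, ‖bathAmp f z v t ν‖ ^ 2 ≤ M) (hC : ∀ t, |v t| ≤ C)
    {g : ℝ → ℝ} (hg : MemLp g 2) (hint : Integrable (hat fun ν => ((g ν * f ν : ℝ) : ℂ))) :
    Tendsto (fun τ => ∫ s, v s * hat (fun ν => ((g ν * f ν : ℝ) : ℂ)) (s - τ)) atTop (𝓝 0) := by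
  set ψ : ℝ → ℂ := fun ν => ((g ν * f ν : ℝ) : ℂ) with hψdef
  have hψ : Integrable ψ := (hg.integrable_mul hf).ofReal
  -- up to phases, what the motion emits during `[-T, T]` is the difference of two amplitudes,
  -- hence bounded in `L²` uniformly in `T`
  have hY : ∀ T : ℝ, (fun ν => Complex.I * f ν * drive v (-T) T ν) =
      fun ν => phase (ν * T) * bathAmp f z v (-T) ν - phase (-(ν * T)) * bathAmp f z v T ν := by
    intro T
    ext ν
    have e : phase (ν * T) * phase (-(ν * T)) = 1 := by rw [← phase_add]; simp
    have e' : phase (ν * -T) = phase (-(ν * T)) := by congr 1; ring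
    rw [← drive_sub hv, bathAmp, bathAmp, e']
    linear_combination (-(Complex.I * f ν * (drive v 0 T ν - drive v 0 (-T) ν))) * e
  have hm1 : ∀ T t, MemLp (fun ν => phase (ν * T) * bathAmp f z v t ν) 2 := fun T t => by
    refine (memLp_bathAmp hf hz hv t).of_le (((by fun_prop : Continuous fun ν : ℝ =>
      phase (ν * T)).aestronglyMeasurable).mul (memLp_bathAmp hf hz hv t).1) ?_
    exact Eventually.of_forall fun ν => by simp [norm_phase]
  have hm2 : ∀ T, MemLp (fun ν => Complex.I * f ν * drive v (-T) T ν) 2 := fun T => by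
    rw [hY]
    have := (hm1 T (-T)).sub (hm1 (-T) T)
    refine this.ae_eq (Eventually.of_forall fun ν => ?_)
    simp
  have hnorm : ∀ T, ‖(hm2 T).toLp‖ ≤ Real.sqrt (4 * M) := fun T => by
    apply Real.le_sqrt_of_sq_le
    rw [norm_toLp_sq]
    have hYν : ∀ ν, Complex.I * f ν * drive v (-T) T ν =
      phase (ν * T) * bathAmp f z v (-T) ν - phase (-(ν * T)) * bathAmp f z v T ν :=
      fun ν => congrFun (hY T) ν
    simp_rw [hYν]
    have h2 := fun t => ((memLp_bathAmp hf hz hv t).integrable_norm_pow two_ne_zero)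
    calc _ ≤ ∫ ν, (2 * ‖bathAmp f z v (-T) ν‖ ^ 2 + 2 * ‖bathAmp f z v T ν‖ ^ 2) := by
          refine integral_mono_of_nonneg (Eventually.of_forall fun ν => by positivity)
            (((h2 (-T)).const_mul 2).add ((h2 T).const_mul 2)) (Eventually.of_forall fun ν => ?_)
          have h3 := norm_sub_le (phase (ν * T) * bathAmp f z v (-T) ν)
            (phase (-(ν * T)) * bathAmp f z v T ν)
          simp only [norm_mul, norm_phase, one_mul] at h3
          refine (pow_le_pow_left₀ (norm_nonneg _) h3 2).trans ?_
          nlinarith [sq_nonneg (‖bathAmp f z v (-T) ν‖ - ‖bathAmp f z v T ν‖)]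
      _ ≤ 4 * M := by
          rw [integral_add ((h2 (-T)).const_mul 2) ((h2 T).const_mul 2), integral_const_mul,
            integral_const_mul]
          linarith [hM T, hM (-T)]
  obtain ⟨w, hw⟩ := exists_weak_clusterPt hnorm
  have hgτ : ∀ τ, MemLp (fun ν => phase (-(ν * τ)) * (g ν : ℂ)) 2 := fun τ => by
    have hgC : MemLp (fun ν => (g ν : ℂ)) 2 := hg.ofReal
    refine hgC.of_le (((by fun_prop : Continuous fun ν : ℝ =>
      phase (-(ν * τ))).aestronglyMeasurable).mul hgC.1) ?_
    exact Eventually.of_forall fun ν => by simp [norm_phase]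
  have hconj : ∀ x, starRingEnd ℂ (phase (-x)) = phase x := fun x => by
    rw [phase, phase, ← Complex.exp_conj]; simp
  have hJ : ∀ τ, ∫ ν, phase (ν * τ) * ((w : ℝ → ℂ) ν * g ν)
      = Complex.I * ∫ s, v s * hat ψ (s - τ) := by
    intro τ
    -- the limit exists along all `T → ∞`, so the cluster point `w` computes it
    have hlim : Tendsto (fun T => inner ℂ ((hgτ τ).toLp) ((hm2 T).toLp)) atTop
        (𝓝 (Complex.I * ∫ s, v s * hat ψ (s - τ))) := by
      have h1 : ∀ T, inner ℂ ((hgτ τ).toLp) ((hm2 T).toLp)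
          = Complex.I * ∫ s in (-T)..T, v s * hat ψ (s - τ) := fun T => by
        rw [inner_toLp_toLp, ← integral_mul_drive hψ hv, ← integral_const_mul]
        congr 1 with ν
        simp only [map_mul, hconj, Complex.conj_ofReal, hψdef]
        push_cast; ring
      simp_rw [h1]
      refine (intervalIntegral_tendsto_integral ?_ tendsto_neg_atTop_atBot tendsto_id).const_mul _
      refine (hint.comp_sub_right τ).bdd_mul (c := C)
        (Complex.continuous_ofReal.comp hv).aestronglyMeasurable
        (Eventually.of_forall fun s => ?_)
      simpa using hC s
    have := hw _ _ hlim
    rw [← this, L2.inner_def]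
    refine integral_congr_ae ?_
    filter_upwards [(hgτ τ).coeFn_toLp] with ν h1
    rw [h1]
    change _ = (w : ℝ → ℂ) ν * starRingEnd ℂ _
    rw [map_mul, hconj, Complex.conj_ofReal]; ring
  have hRL := (tendsto_integral_phase_mul (fun ν => (w : ℝ → ℂ) ν * g ν)).const_mul (-Complex.I)
  rw [mul_zero] at hRL
  refine hRL.congr fun τ => ?_
  rw [hJ, ← mul_assoc]; simp

end core

/-! ### A motion with bounded bath comes to rest -/

open FourierTransform in
lemma hat_eq_fourier (ψ : ℝ → ℂ) (s : ℝ) : hat ψ s = 𝓕 ψ (s / (2 * Real.pi)) := by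
  rw [Real.fourier_real_eq_integral_exp_smul, hat]
  congr 1 with ν
  rw [smul_eq_mul, phase]
  congr 3
  have := Real.pi_pos.ne'
  field_simp

open FourierTransform in
lemma integrable_hat_of_contDiff {φ : ℝ → ℝ} (h1 : ContDiff ℝ ∞ φ) (h2 : HasCompactSupport φ) :
    Integrable (hat fun ν => (φ ν : ℂ)) := by
  have h1' : ContDiff ℝ ∞ (fun ν => (φ ν : ℂ)) := Complex.ofRealCLM.contDiff.comp h1
  have h2' : HasCompactSupport (fun ν => (φ ν : ℂ)) := h2.comp_left Complex.ofReal_zero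
  have h := (𝓕 (h2'.toSchwartzMap h1')).integrable (μ := volume)
  have h3 := h.comp_div (R := 2 * Real.pi) (by positivity)
  refine h3.congr (Eventually.of_forall fun s => ?_)
  rw [hat_eq_fourier]
  rfl

lemma hat_comp_div (ψ : ℝ → ℂ) {a : ℝ} (ha : 0 < a) (s : ℝ) :
    hat (fun ν => ψ (ν / a)) s = a * hat ψ (a * s) := by
  have h := Measure.integral_comp_div (fun x : ℝ => phase (-(x * (a * s))) * ψ x) a
  rw [abs_of_pos ha, Complex.real_smul] at h
  rw [hat, hat, ← h]
  congr 1 with ν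
  congr 2
  field_simp

open FourierTransform in
/-- A smooth cutoff `χ`, equal to `1` near the origin, and its rapidly decreasing transform. -/
lemma exists_cutoff : ∃ (χ : ℝ → ℝ) (h : SchwartzMap ℝ ℂ), ContDiff ℝ ∞ χ ∧ HasCompactSupport χ ∧
    (∀ᶠ ν in 𝓝 0, χ ν = 1) ∧ (∀ s, hat (fun ν => (χ ν : ℂ)) s = h s) ∧ ∫ s, h s ≠ 0 := by
  let b : ContDiffBump (0 : ℝ) := ⟨1, 2, one_pos, one_lt_two⟩
  have h1 : ContDiff ℝ ∞ (fun ν => (b ν : ℂ)) := Complex.ofRealCLM.contDiff.comp b.contDiff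
  have h2 : HasCompactSupport (fun ν => (b ν : ℂ)) :=
    b.hasCompactSupport.comp_left Complex.ofReal_zero
  set B := h2.toSchwartzMap h1 with hB
  have hpi : (0 : ℝ) < 2 * Real.pi := by positivity
  refine ⟨fun ν => b (ν / (2 * Real.pi)), ((2 * Real.pi : ℝ) : ℂ) • 𝓕 B,
    b.contDiff.comp (by fun_prop), ?_, ?_, fun s => ?_, ?_⟩
  · exact b.hasCompactSupport.comp_homeomorph
      ((Homeomorph.mulRight₀ (2 * Real.pi)⁻¹ (by positivity)))
  · have : Tendsto (fun ν : ℝ => ν / (2 * Real.pi)) (𝓝 0) (𝓝 0) := by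
      have : Continuous (fun ν : ℝ => ν / (2 * Real.pi)) := by fun_prop
      simpa using this.tendsto 0
    exact this.eventually b.eventuallyEq_one
  · have := hat_comp_div (fun ν => (b ν : ℂ)) hpi s
    rw [this, hat_eq_fourier]
    have e : 2 * Real.pi * s / (2 * Real.pi) = s := by field_simp
    rw [e]
    rfl
  · have h3 : ∫ s, 𝓕 B s = 1 := by
      have h4 : 𝓕⁻ (𝓕 (B : ℝ → ℂ)) = B :=
        B.continuous.fourierInv_fourier_eq B.integrable (𝓕 B).integrable
      have h5 := congrFun h4 0
      rw [Real.fourierInv_eq'] at h5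
      simp only [inner_zero_right, mul_zero, Complex.ofReal_zero, zero_mul, Complex.exp_zero,
        one_smul] at h5
      have h6 : B 0 = 1 := by
        change ((b 0 : ℝ) : ℂ) = 1
        rw [b.eventuallyEq_one.self_of_nhds]; simp
      rw [h6] at h5
      exact h5
    simp only [smul_apply, smul_eq_mul]
    rw [integral_const_mul, h3, mul_one]
    exact_mod_cast hpi.ne'

/-- Averaging a Lipschitz function `v` against a kernel of width `1/a` hardly changes it when `a` is
large. -/
lemma norm_integral_comp_sub_le {v : ℝ → ℝ} {C L : ℝ} (hv : Continuous v) (hC : ∀ t, |v t| ≤ C)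
    (hL : ∀ s t, |v s - v t| ≤ L * |s - t|) (h : SchwartzMap ℝ ℂ) {a : ℝ} (ha : 0 < a) (τ : ℝ) :
    ‖(∫ s, (v (s / a + τ) : ℂ) * h s) - v τ * ∫ s, h s‖ ≤ L / a * ∫ s, ‖s‖ ^ 1 * ‖h s‖ := by
  have hi : Integrable fun s => (v (s / a + τ) : ℂ) * h s :=
    h.integrable.bdd_mul (c := C) (by fun_prop) (Eventually.of_forall fun s => by simpa using hC _)
  rw [← integral_const_mul, ← integral_sub hi (h.integrable.const_mul _), ← integral_const_mul]
  refine norm_integral_le_of_norm_le ((h.integrable_pow_mul volume 1).const_mul _)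
    (Eventually.of_forall fun s => ?_)
  rw [← sub_mul, norm_mul, ← mul_assoc, ← Complex.ofReal_sub, Complex.norm_real, Real.norm_eq_abs]
  gcongr
  refine (hL _ _).trans_eq ?_
  rw [add_sub_cancel_right, abs_div, abs_of_pos ha, pow_one, Real.norm_eq_abs]
  ring

/-- The velocity `v` of a bounded motion `q` nearly averages out against a kernel of width `1/e` when
`e` is small, as one sees by integrating by parts. -/
lemma norm_integral_comp_le {q v : ℝ → ℝ} {C B : ℝ} (hv : Continuous v) (hC : ∀ t, |v t| ≤ C)
    (hq : ∀ t, HasDerivAt q (v t) t) (hB : ∀ t, |q t| ≤ B)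
    (h : SchwartzMap ℝ ℂ) {e : ℝ} (he : 0 < e) (τ : ℝ) :
    ‖∫ s, (v (s / e + τ) : ℂ) * h s‖ ≤ e * B * ∫ s, ‖SchwartzMap.derivCLM ℂ ℂ h s‖ := by
  have hqc : Continuous q := continuous_iff_continuousAt.mpr fun t => (hq t).continuousAt
  have hu : ∀ s : ℝ, HasDerivAt (fun s : ℝ => ((e * q (s / e + τ) : ℝ) : ℂ)) (v (s / e + τ)) s := by
    intro s
    have h1 : HasDerivAt (fun s : ℝ => s / e + τ) (1 / e) s :=
      ((hasDerivAt_id s).div_const e).add_const τ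
    have h2 := ((hq (s / e + τ)).comp s h1).const_mul e
    refine h2.ofReal_comp.congr_deriv ?_
    push_cast
    have : (e : ℂ) ≠ 0 := by exact_mod_cast he.ne'
    field_simp
  have hbq : ∀ s : ℝ, ‖((e * q (s / e + τ) : ℝ) : ℂ)‖ ≤ e * B := fun s => by
    rw [Complex.norm_real, Real.norm_eq_abs, abs_mul, abs_of_pos he]
    gcongr; exact hB _
  have hd : ∀ s, HasDerivAt h (SchwartzMap.derivCLM ℂ ℂ h s) s := fun s => by
    rw [SchwartzMap.derivCLM_apply]; exact h.differentiableAt.hasDerivAt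
  have hcq : AEStronglyMeasurable (fun s : ℝ => ((e * q (s / e + τ) : ℝ) : ℂ)) volume := by fun_prop
  have key := integral_mul_deriv_eq_deriv_mul_of_integrable (fun s _ => hu s) (fun s _ => hd s)
    ((SchwartzMap.derivCLM ℂ ℂ h).integrable.bdd_mul hcq (Eventually.of_forall hbq))
    (h.integrable.bdd_mul (c := C) (by fun_prop)
      (Eventually.of_forall fun s => by simpa using hC _))
    (h.integrable.bdd_mul hcq (Eventually.of_forall hbq))
  rw [← norm_neg, ← key, ← integral_const_mul]
  refine norm_integral_le_of_norm_le ((SchwartzMap.derivCLM ℂ ℂ h).integrable.norm.const_mul _)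
    (Eventually.of_forall fun s => ?_)
  rw [norm_mul]
  gcongr
  exact hbq s

lemma continuous_div_of_tsupport_subset {φ f : ℝ → ℝ} (hφ : Continuous φ)
    (hs : tsupport φ ⊆ {0}ᶜ) (hf : ContinuousOn f {0}ᶜ) (hf0 : ∀ ν ≠ 0, f ν ≠ 0) :
    Continuous fun ν => φ ν / f ν := by
  refine continuous_of_tsupport fun ν hν => ?_
  have h1 : ν ∈ tsupport φ := by
    refine closure_mono (fun x hx => ?_) hν
    simp only [Function.mem_support, ne_eq, div_eq_zero_iff, not_or] at hx
    exact hx.1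
  have h2 : ν ≠ 0 := hs h1
  exact hφ.continuousAt.div (hf.continuousAt (isOpen_compl_singleton.mem_nhds h2)) (hf0 ν h2)

lemma memLp_div_of_tsupport_subset {φ f : ℝ → ℝ} (hφ : Continuous φ) (hc : HasCompactSupport φ)
    (hs : tsupport φ ⊆ {0}ᶜ) (hf : ContinuousOn f {0}ᶜ) (hf0 : ∀ ν ≠ 0, f ν ≠ 0) :
    MemLp (fun ν => φ ν / f ν) 2 :=
  (continuous_div_of_tsupport_subset hφ hs hf hf0).memLp_of_hasCompactSupport (by
    refine hc.mono fun x hx => ?_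
    simp only [Function.mem_support, ne_eq, div_eq_zero_iff, not_or] at hx
    exact hx.1)

lemma div_mul_cancel_of_tsupport_subset {φ f : ℝ → ℝ}
    (hs : tsupport φ ⊆ {0}ᶜ) (hf0 : ∀ ν ≠ 0, f ν ≠ 0) (ν : ℝ) : φ ν / f ν * f ν = φ ν := by
  by_cases h : ν = 0
  · have : φ ν = 0 := image_eq_zero_of_notMem_tsupport fun h' => hs h' h
    simp [this]
  · exact div_mul_cancel₀ _ (hf0 ν h)

section core

variable {f : ℝ → ℝ} {z : ℝ → ℂ} {v : ℝ → ℝ}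

/-- A bounded motion with bounded, Lipschitz velocity `v` that leaves its bath bounded in `L²` for
all times comes to rest: `v` has no oscillating part since that would be radiated into the bath,
and no constant part since the motion is bounded. -/
theorem tendsto_zero_of_bathAmp_bounded (hf : MemLp f 2) (hfc : ContinuousOn f {0}ᶜ)
    (hf0 : ∀ ν ≠ 0, f ν ≠ 0) (hz : MemLp z 2) (hv : Continuous v)
    {M C B L : ℝ} (hM : ∀ t, ∫ ν, ‖bathAmp f z v t ν‖ ^ 2 ≤ M) (hC : ∀ t, |v t| ≤ C)
    (hL : ∀ s t, |v s - v t| ≤ L * |s - t|) {q : ℝ → ℝ} (hq : ∀ t, HasDerivAt q (v t) t)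
    (hB : ∀ t, |q t| ≤ B) : Tendsto v atTop (𝓝 0) := by
  obtain ⟨χ, h, hχ1, hχ2, hχ3, hχh, hI⟩ := exists_cutoff
  set I := ∫ s, h s with hIdef
  have hIpos : 0 < ‖I‖ := norm_pos_iff.mpr hI
  set C1 := ∫ s, ‖s‖ ^ 1 * ‖h s‖ with hC1
  set C2 := ∫ s, ‖SchwartzMap.derivCLM ℂ ℂ h s‖ with hC2
  -- the estimate for a band-pass kernel that keeps the frequencies between `e` and `a`
  have main : ∀ a e : ℝ, 0 < a → 0 < e → ∃ J : ℝ → ℝ, Tendsto J atTop (𝓝 0) ∧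
      ∀ τ, ‖I‖ * |v τ| ≤ J τ + L / a * C1 + e * B * C2 := by
    intro a e ha he
    set φ : ℝ → ℝ := fun ν => χ (ν / a) - χ (ν / e) with hφ
    have hφ1 : ContDiff ℝ ∞ φ := (hχ1.comp (by fun_prop)).sub (hχ1.comp (by fun_prop))
    have hsc : ∀ c : ℝ, 0 < c → HasCompactSupport (fun ν => χ (ν / c)) := fun c hc =>
      hχ2.comp_homeomorph ((Homeomorph.mulRight₀ c⁻¹ (by positivity)))
    have hφ2 : HasCompactSupport φ := (hsc a ha).sub (hsc e he)
    have hφ3 : tsupport φ ⊆ {0}ᶜ := by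
      rw [Set.subset_compl_singleton_iff, notMem_tsupport_iff_eventuallyEq]
      have hc : ∀ c : ℝ, ∀ᶠ ν in 𝓝 (0 : ℝ), χ (ν / c) = 1 := fun c => by
        have : Tendsto (fun ν : ℝ => ν / c) (𝓝 0) (𝓝 0) := by
          have : Continuous (fun ν : ℝ => ν / c) := by fun_prop
          simpa using this.tendsto 0
        exact this.eventually hχ3
      filter_upwards [hc a, hc e] with ν h1 h2
      simp [hφ, h1, h2]
    have hgf := div_mul_cancel_of_tsupport_subset hφ3 hf0
    have hJ := tendsto_integral_mul_hat hf hz hv hM hC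
      (memLp_div_of_tsupport_subset hφ1.continuous hφ2 hφ3 hfc hf0)
      (by simp_rw [hgf]; exact integrable_hat_of_contDiff hφ1 hφ2)
    simp_rw [hgf] at hJ
    refine ⟨_, by simpa using hJ.norm, fun τ => ?_⟩
    have hχi : ∀ c : ℝ, 0 < c → Integrable fun ν => (χ (ν / c) : ℂ) := fun c hc =>
      ((hχ1.continuous.comp (by fun_prop)).integrable_of_hasCompactSupport (hsc c hc)).ofReal
    have hhat : ∀ s, hat (fun ν => (φ ν : ℂ)) s = a * h (a * s) - e * h (e * s) := fun s => by
      rw [← hχh, ← hχh, ← hat_comp_div _ ha, ← hat_comp_div _ he, hat, hat, hat, ← integral_sub]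
      · congr 1 with ν
        simp only [hφ]; push_cast; ring
      · exact (hχi a ha).bdd_mul (c := 1) (by fun_prop)
          (Eventually.of_forall fun ν => (norm_phase _).le)
      · exact (hχi e he).bdd_mul (c := 1) (by fun_prop)
          (Eventually.of_forall fun ν => (norm_phase _).le)
    have hvi : ∀ c : ℝ, 0 < c → Integrable fun s => (v (s + τ) : ℂ) * (c * h (c * s)) :=
      fun c hc => ((h.integrable.comp_mul_left' hc.ne').const_mul (c : ℂ)).bdd_mul (c := C)
        (by fun_prop) (Eventually.of_forall fun s => by simpa using hC _)
    have hsub : ∀ c : ℝ, 0 < c → ∫ s, (v (s + τ) : ℂ) * (c * h (c * s))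
        = ∫ s, (v (s / c + τ) : ℂ) * h s := fun c hc => by
      have := Measure.integral_comp_mul_left (fun s : ℝ => (v (s / c + τ) : ℂ) * h s) c
      rw [abs_of_pos (inv_pos.mpr hc), Complex.real_smul] at this
      have h2 : ∫ s, (v (s / c + τ) : ℂ) * h s
          = c * ∫ (x : ℝ), (v (c * x / c + τ) : ℂ) * h (c * x) := by
        rw [this, ← mul_assoc, ← Complex.ofReal_mul, mul_inv_cancel₀ hc.ne']; simp
      rw [h2, ← integral_const_mul]
      congr 1 with s
      rw [mul_div_cancel_left₀ _ hc.ne']; ring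
    have hJeq : ∫ s, (v s : ℂ) * hat (fun ν => (φ ν : ℂ)) (s - τ)
        = (∫ s, (v (s / a + τ) : ℂ) * h s) - ∫ s, (v (s / e + τ) : ℂ) * h s := by
      rw [← integral_add_right_eq_self _ τ, ← hsub a ha, ← hsub e he,
        ← integral_sub (hvi a ha) (hvi e he)]
      congr 1 with s
      rw [add_sub_cancel_right, hhat]; ring
    rw [hJeq]
    have e1 := norm_integral_comp_sub_le hv hC hL h ha τ
    have e2 := norm_integral_comp_le hv hC hq hB h he τ
    set X := ∫ s, (v (s / a + τ) : ℂ) * h s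
    set Y := ∫ s, (v (s / e + τ) : ℂ) * h s
    have e3 : ‖I‖ * |v τ| = ‖(X - Y) - (X - v τ * I) + Y‖ := by
      rw [show (X - Y) - (X - v τ * I) + Y = v τ * I by ring, norm_mul, Complex.norm_real,
        Real.norm_eq_abs, mul_comm]
    rw [e3]
    exact (norm_add_le _ _).trans (add_le_add ((norm_sub_le _ _).trans (add_le_add_right e1 _)) e2)
  rw [Metric.tendsto_atTop]
  intro ε hε
  have hδ : 0 < ‖I‖ * ε / 3 := by positivity
  obtain ⟨a, ha, ha'⟩ : ∃ a : ℝ, 0 < a ∧ L / a * C1 < ‖I‖ * ε / 3 := by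
    have : Tendsto (fun a : ℝ => L / a * C1) atTop (𝓝 0) := by
      simpa using (tendsto_const_nhds.div_atTop tendsto_id (a := L)).mul_const C1
    exact ((eventually_gt_atTop 0).and (this.eventually_lt_const hδ)).exists
  obtain ⟨e, he, he'⟩ : ∃ e : ℝ, 0 < e ∧ e * B * C2 < ‖I‖ * ε / 3 := by
    have hc : Continuous (fun e : ℝ => e * B * C2) := by fun_prop
    have : Tendsto (fun e : ℝ => e * B * C2) (𝓝[>] 0) (𝓝 0) := by
      simpa using (hc.tendsto 0).mono_left nhdsWithin_le_nhds
    exact ((eventually_mem_nhdsWithin (a := (0 : ℝ)) (s := Set.Ioi 0)).and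
      (this.eventually_lt_const hδ)).exists
  obtain ⟨J, hJ, hb⟩ := main a e ha he
  obtain ⟨T, hT⟩ := (hJ.eventually_lt_const hδ).exists_forall_of_atTop
  refine ⟨T, fun τ hτ => ?_⟩
  rw [Real.dist_eq, sub_zero]
  have := hb τ
  have := hT τ hτ
  by_contra hcon
  push Not at hcon
  nlinarith

end core

/-! ### Weak decay of the bath amplitude -/

/-- Convolution of an integrable kernel with a bounded function tending to zero. -/
lemma tendsto_integral_interval_mul_comp_sub {k : ℝ → ℂ} (hk : Integrable k) {v : ℝ → ℝ}
    (hv : Continuous v) {C : ℝ} (hC : ∀ t, |v t| ≤ C) (h0 : Tendsto v atTop (𝓝 0)) :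
    Tendsto (fun t : ℝ => ∫ s in (0)..t, v s * k (s - t)) atTop (𝓝 0) := by
  have h1 : Tendsto (fun t : ℝ => ∫ s, (Set.Ioc (-t) 0).indicator (fun s => v (s + t) * k s) s)
      atTop (𝓝 (∫ _ : ℝ, (0 : ℂ))) := by
    refine tendsto_integral_filter_of_dominated_convergence (fun s => C * ‖k s‖) ?_ ?_
      (hk.norm.const_mul C) ?_
    · refine Eventually.of_forall fun t => AEStronglyMeasurable.indicator ?_ measurableSet_Ioc
      exact (by fun_prop : Continuous fun s : ℝ => (v (s + t) : ℂ)).aestronglyMeasurable.mul hk.1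
    · refine Eventually.of_forall fun t => Eventually.of_forall fun s => ?_
      refine (norm_indicator_le_norm_self _ _).trans ?_
      rw [norm_mul, Complex.norm_real]
      gcongr; exact hC _
    · refine Eventually.of_forall fun s => ?_
      have h2 : Tendsto (fun t => (v (s + t) : ℂ) * k s) atTop (𝓝 0) := by
        have := (Complex.continuous_ofReal.tendsto 0).comp
          (h0.comp (tendsto_atTop_add_const_left atTop s tendsto_id))
        simpa using this.mul_const (k s)
      refine squeeze_zero_norm (fun t => norm_indicator_le_norm_self _ _) ?_
      simpa using h2.norm
  rw [integral_zero] at h1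
  refine h1.congr' ?_
  filter_upwards [eventually_ge_atTop 0] with t ht
  rw [integral_indicator measurableSet_Ioc, ← intervalIntegral.integral_of_le (by linarith)]
  have := intervalIntegral.integral_comp_add_right (a := -t) (b := 0)
    (fun s : ℝ => (v s : ℂ) * k (s - t)) t
  simp only [add_sub_cancel_right, neg_add_cancel, zero_add] at this
  exact this

section core

variable {f : ℝ → ℝ} {z : ℝ → ℂ} {v : ℝ → ℝ}

/-- When the motion comes to rest, the amplitude of the bath tends to zero weakly in `L²`. -/
theorem tendsto_integral_mul_bathAmp (hf : MemLp f 2) (hfc : ContinuousOn f {0}ᶜ)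
    (hf0 : ∀ ν ≠ 0, f ν ≠ 0) (hz : MemLp z 2) (hv : Continuous v)
    {M C : ℝ} (hM : ∀ t, ∫ ν, ‖bathAmp f z v t ν‖ ^ 2 ≤ M) (hC : ∀ t, |v t| ≤ C)
    (h0 : Tendsto v atTop (𝓝 0)) {g : ℝ → ℝ} (hg : MemLp g 2) :
    Tendsto (fun t => ∫ ν, (g ν : ℂ) * bathAmp f z v t ν) atTop (𝓝 0) := by
  have hZ := memLp_bathAmp hf hz hv
  set y : ℝ → Lp ℂ 2 (volume : Measure ℝ) := fun t => (hZ t).toLp with hy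
  have hyM : ∀ t, ‖y t‖ ≤ Real.sqrt M := fun t => by
    apply Real.le_sqrt_of_sq_le
    rw [hy, norm_toLp_sq]; exact hM t
  -- the test functions for which the claim holds form a closed subspace `S`
  let S : Submodule ℂ (Lp ℂ 2 (volume : Measure ℝ)) :=
    { carrier := {w | Tendsto (fun t => inner ℂ w (y t)) atTop (𝓝 0)}
      zero_mem' := by simp
      add_mem' := fun {a b} ha hb => by
        simpa [inner_add_left] using Tendsto.add ha hb
      smul_mem' := fun c w hw => by
        simpa [inner_smul_left] using Tendsto.const_mul (starRingEnd ℂ c) hw }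
  have hSclosed : IsClosed (S : Set (Lp ℂ 2 (volume : Measure ℝ))) := by
    rw [← closure_subset_iff_isClosed]
    intro w hw
    change Tendsto (fun t => inner ℂ w (y t)) atTop (𝓝 0)
    rw [Metric.tendsto_atTop]
    intro ε hε
    have hM1 : 0 < Real.sqrt M + 1 := by positivity
    obtain ⟨w', hw', hd⟩ := Metric.mem_closure_iff.mp hw (ε / 2 / (Real.sqrt M + 1)) (by positivity)
    obtain ⟨T, hT⟩ := Metric.tendsto_atTop.mp
      (show Tendsto (fun t => inner ℂ w' (y t)) atTop (𝓝 0) from hw') (ε / 2) (by positivity)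
    refine ⟨T, fun t ht => ?_⟩
    have h1 := hT t ht
    rw [dist_zero_right] at h1 ⊢
    have h2 : ‖inner ℂ (w - w') (y t)‖ < ε / 2 := by
      refine (norm_inner_le_norm _ _).trans_lt ?_
      rw [dist_eq_norm] at hd
      calc ‖w - w'‖ * ‖y t‖ ≤ ‖w - w'‖ * (Real.sqrt M + 1) := by
            gcongr; exact (hyM t).trans (by linarith)
        _ < ε / 2 / (Real.sqrt M + 1) * (Real.sqrt M + 1) := by gcongr
        _ = ε / 2 := by field_simp
    have h3 : inner ℂ w (y t) = inner ℂ (w - w') (y t) + inner ℂ w' (y t) := by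
      rw [← inner_add_left, sub_add_cancel]
    rw [h3]
    exact (norm_add_le _ _).trans_lt (by linarith)
  -- `S` contains the functions `φ / f` with `φ` smooth and supported away from the origin
  have hφS : ∀ φ : ℝ → ℝ, ContDiff ℝ ∞ φ → HasCompactSupport φ → tsupport φ ⊆ {0}ᶜ →
      ∀ hm : MemLp (fun ν => ((φ ν / f ν : ℝ) : ℂ)) 2 volume, hm.toLp ∈ S := by
    intro φ h1 h2 h3 hm
    change Tendsto (fun t => inner ℂ (hm.toLp _) (y t)) atTop (𝓝 0)
    have hfz : Integrable (fun ν => ((φ ν / f ν : ℝ) : ℂ) * z ν) volume := hm.integrable_mul hz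
    have hφi : Integrable (fun ν => (φ ν : ℂ)) :=
      (h1.continuous.integrable_of_hasCompactSupport (μ := volume) h2).ofReal
    have e : ∀ t, inner ℂ (hm.toLp _) (y t)
        = (∫ ν, phase (ν * t) * (((φ ν / f ν : ℝ) : ℂ) * z ν))
          - Complex.I * ∫ s in (0)..t, v s * hat (fun ν => (φ ν : ℂ)) (s - t) := fun t => by
      rw [hy, inner_toLp_toLp, ← integral_mul_drive hφi hv, ← integral_const_mul, ← integral_sub]
      · congr 1 with ν
        have e1 : ((φ ν / f ν : ℝ) : ℂ) * f ν = φ ν := by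
          exact_mod_cast div_mul_cancel_of_tsupport_subset h3 hf0 ν
        rw [Complex.conj_ofReal, bathAmp]
        linear_combination (-phase (ν * t) * Complex.I * drive v 0 t ν) * e1
      · exact hfz.bdd_mul (c := 1) (by fun_prop)
          (Eventually.of_forall fun ν => (norm_phase _).le)
      · obtain ⟨B, -, hB⟩ := exists_drive_bound hv |t|
        have h5 : Continuous fun ν : ℝ => phase (ν * t) * drive v 0 t ν :=
          (by fun_prop : Continuous fun ν : ℝ => phase (ν * t)).mul (continuous_drive hv 0 t)
        have h4 := hφi.bdd_mul (c := B) (f := fun ν => phase (ν * t) * drive v 0 t ν)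
          h5.aestronglyMeasurable (Eventually.of_forall fun ν => by
            rw [norm_mul, norm_phase, one_mul]; exact (hB t le_rfl).2 ν)
        refine (h4.const_mul Complex.I).congr (Eventually.of_forall fun ν => ?_)
        ring
    simp_rw [e]
    have l1 := tendsto_integral_phase_mul (fun ν => ((φ ν / f ν : ℝ) : ℂ) * z ν)
    have l2 := tendsto_integral_interval_mul_comp_sub (integrable_hat_of_contDiff h1 h2) hv hC h0
    simpa using l1.sub (l2.const_mul Complex.I)
  -- as `f` does not vanish off the origin, nothing is orthogonal to these functions
  have hStop : S = ⊤ := by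
    have : CompleteSpace S := hSclosed.completeSpace_coe
    rw [← Submodule.orthogonal_eq_bot_iff, Submodule.eq_bot_iff]
    intro w hw
    have hfinv : ContinuousOn (fun ν => ((f ν)⁻¹ : ℝ)) {0}ᶜ := hfc.inv₀ fun ν hν => hf0 ν hν
    have hloc : LocallyIntegrableOn (fun ν => (((f ν)⁻¹ : ℝ) : ℂ) * (w : ℝ → ℂ) ν) {0}ᶜ volume := by
      have h1 : LocallyIntegrableOn (w : ℝ → ℂ) {0}ᶜ volume :=
        ((Lp.memLp w).locallyIntegrable one_le_two).locallyIntegrableOn _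
      exact h1.continuousOn_mul (Complex.continuous_ofReal.comp_continuousOn hfinv)
        isOpen_compl_singleton.isLocallyClosed
    have hae := isOpen_compl_singleton.ae_eq_zero_of_integral_contDiff_smul_eq_zero hloc
      (fun φ h1 h2 h3 => by
        have hm : MemLp (fun ν => ((φ ν / f ν : ℝ) : ℂ)) 2 :=
          (memLp_div_of_tsupport_subset h1.continuous h2 h3 hfc hf0).ofReal
        have h4 := (Submodule.mem_orthogonal _ _).mp hw _ (hφS φ h1 h2 h3 hm)
        rw [L2.inner_def] at h4
        rw [← h4]
        refine integral_congr_ae ?_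
        filter_upwards [hm.coeFn_toLp] with ν h5
        rw [h5]
        change _ = (w : ℝ → ℂ) ν * starRingEnd ℂ _
        rw [Complex.conj_ofReal, Complex.real_smul]
        push_cast
        rw [div_eq_mul_inv]; ring)
    rw [Lp.eq_zero_iff_ae_eq_zero]
    have hne : ∀ᵐ ν : ℝ, ν ≠ 0 := by simp [ae_iff]
    filter_upwards [hae, hne] with ν h1 h2
    have := h1 h2
    simpa [hf0 ν h2] using this
  have hgC : MemLp (fun ν => (g ν : ℂ)) 2 := hg.ofReal
  have hgS : hgC.toLp ∈ S := hStop ▸ Submodule.mem_top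
  have h7 : Tendsto (fun t => inner ℂ (hgC.toLp) (y t)) atTop (𝓝 0) := hgS
  refine h7.congr fun t => ?_
  rw [hy, inner_toLp_toLp]
  congr 1 with ν
  rw [Complex.conj_ofReal]; ring

end core

/-! ### Limits of functions and of their derivatives at infinity -/

lemma abs_sub_le_of_hasDerivAt {a a' : ℝ → ℝ} {L : ℝ} (h : ∀ t, HasDerivAt a (a' t) t)
    (hL : ∀ t, |a' t| ≤ L) (s t : ℝ) : |a s - a t| ≤ L * |s - t| :=
  convex_univ.norm_image_sub_le_of_norm_hasDerivWithin_le
    (fun x _ => (h x).hasDerivWithinAt) (fun x _ => hL x) (Set.mem_univ t) (Set.mem_univ s)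

/-- The mean value theorem on `[t, t + δ]`. -/
lemma exists_hasDerivAt_eq_add {φ φ' : ℝ → ℝ} (h : ∀ t, HasDerivAt φ (φ' t) t) (t : ℝ) {δ : ℝ}
    (hδ : 0 < δ) : ∃ s, t < s ∧ s < t + δ ∧ φ (t + δ) - φ t = δ * φ' s := by
  obtain ⟨s, hs, e⟩ := exists_hasDerivAt_eq_slope φ φ' (lt_add_of_pos_right t hδ)
    (fun x _ => (h x).continuousAt.continuousWithinAt) (fun x _ => h x)
  refine ⟨s, hs.1, hs.2, ?_⟩
  rw [e, add_sub_cancel_left, mul_div_cancel₀ _ hδ.ne']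

/-- A variant of Barbalat's lemma: if `φ` converges at `+∞`, the part `a` of its derivative which is
Lipschitz tends to zero, as soon as the remaining part does. -/
lemma tendsto_zero_of_hasDerivAt_add {φ a b : ℝ → ℝ} {c L : ℝ}
    (hφ : ∀ t, HasDerivAt φ (a t + b t) t) (hc : Tendsto φ atTop (𝓝 c))
    (hb : Tendsto b atTop (𝓝 0)) (hL : ∀ s t, |a s - a t| ≤ L * |s - t|) :
    Tendsto a atTop (𝓝 0) := by
  have hL0 : 0 ≤ L := by simpa using (abs_nonneg _).trans (hL 1 0)
  rw [Metric.tendsto_atTop]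
  intro ε hε
  -- over a time `δ`, the Lipschitz function varies by at most `ε / 4`
  set δ := ε / (4 * (L + 1)) with hδdef
  have hδ : 0 < δ := by positivity
  have hLδ : L * δ ≤ ε / 4 := by
    rw [hδdef, ← mul_div_assoc, div_le_div_iff₀ (by positivity) (by positivity)]; nlinarith
  have h1 : Tendsto (fun t => φ (t + δ) - φ t) atTop (𝓝 0) := by
    simpa using (hc.comp (tendsto_atTop_add_const_right atTop δ tendsto_id)).sub hc
  obtain ⟨T1, hT1⟩ := Metric.tendsto_atTop.mp h1 (δ * (ε / 4)) (by positivity)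
  obtain ⟨T2, hT2⟩ := Metric.tendsto_atTop.mp hb (ε / 4) (by positivity)
  refine ⟨max T1 T2, fun t ht => ?_⟩
  obtain ⟨s, hs1, hs2, e⟩ := exists_hasDerivAt_eq_add hφ t hδ
  have e1 := hT1 t ((le_max_left _ _).trans ht)
  have e2 := hT2 s ((le_max_right _ _).trans (ht.trans hs1.le))
  rw [dist_zero_right, Real.norm_eq_abs] at e1 e2 ⊢
  rw [e, abs_mul, abs_of_pos hδ] at e1
  have e3 : |a s + b s| < ε / 4 := lt_of_mul_lt_mul_left e1 hδ.le
  have e4 : |a t - a s| ≤ ε / 4 := (hL t s).trans (le_trans (by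
    gcongr
    rw [abs_le]; constructor <;> linarith) hLδ)
  have e5 : a t = (a t - a s) + (a s + b s) - b s := by ring
  rw [e5]
  have := abs_sub ((a t - a s) + (a s + b s)) (b s)
  have := abs_add_le (a t - a s) (a s + b s)
  linarith

/-- The limit of the derivative of a convergent function is zero. -/
lemma eq_zero_of_tendsto_hasDerivAt {φ φ' : ℝ → ℝ} {c c' : ℝ} (h : ∀ t, HasDerivAt φ (φ' t) t)
    (hc : Tendsto φ atTop (𝓝 c)) (hc' : Tendsto φ' atTop (𝓝 c')) : c' = 0 := by
  choose s hs1 hs2 hs using fun t => exists_hasDerivAt_eq_add h t one_pos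
  have h1 : Tendsto (fun t => φ (t + 1) - φ t) atTop (𝓝 0) := by
    simpa using (hc.comp (tendsto_atTop_add_const_right atTop 1 tendsto_id)).sub hc
  have h2 : Tendsto s atTop atTop := tendsto_atTop_mono (fun t => (hs1 t).le) tendsto_id
  refine tendsto_nhds_unique (hc'.comp h2) (h1.congr fun t => ?_)
  simp [hs t]

/-- If `w` has isolated zeros and `w(x) x' → 0` along a bounded motion `x`, then `x' → 0`: the
strictly increasing primitive `Ψ` of `|w|` turns a uniform displacement of `x` into a uniform
displacement of `Ψ(x)`. -/
lemma tendsto_zero_of_mul_tendsto_zero {w x y : ℝ → ℝ} {R L : ℝ} (hw : Continuous w)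
    (hiso : ∀ u, w u = 0 → ∀ᶠ u' in 𝓝[≠] u, w u' ≠ 0)
    (hx : ∀ t, HasDerivAt x (y t) t) (hR : ∀ t, |x t| ≤ R)
    (hL : ∀ s t, |y s - y t| ≤ L * |s - t|)
    (h0 : Tendsto (fun t => w (x t) * y t) atTop (𝓝 0)) : Tendsto y atTop (𝓝 0) := by
  have hL0 : 0 ≤ L := by simpa using (abs_nonneg _).trans (hL 1 0)
  set Ψ : ℝ → ℝ := fun u => ∫ s in (0)..u, |w s| with hΨ
  have hΨd : ∀ u, HasDerivAt Ψ |w u| u := fun u =>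
    (hw.abs.integral_hasStrictDerivAt 0 u).hasDerivAt
  have hΨc : Continuous Ψ := continuous_iff_continuousAt.mpr fun u => (hΨd u).continuousAt
  have hmono : StrictMono Ψ := fun u u' huu' => by
    have h1 : Ψ u' - Ψ u = ∫ s in u..u', |w s| :=
      intervalIntegral.integral_interval_sub_left (hw.abs.intervalIntegrable _ _)
        (hw.abs.intervalIntegrable _ _)
    have h2 : 0 < ∫ s in u..u', |w s| := by
      refine intervalIntegral.integral_pos huu' hw.abs.continuousOn (fun _ _ => abs_nonneg _) ?_
      by_cases hm : w ((u + u') / 2) = 0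
      · have hI : ∀ᶠ c in 𝓝[≠] ((u + u') / 2), c ∈ Set.Icc u u' :=
          nhdsWithin_le_nhds (Icc_mem_nhds (by linarith) (by linarith))
        obtain ⟨c, hc1, hc2⟩ := ((hiso _ hm).and hI).exists
        exact ⟨c, hc2, abs_pos.mpr hc1⟩
      · exact ⟨_, ⟨by linarith, by linarith⟩, abs_pos.mpr hm⟩
    linarith
  rw [Metric.tendsto_atTop]
  intro ε hε
  -- over a time `δ`, the Lipschitz function varies by at most `ε / 4`
  set δ := ε / (4 * (L + 1)) with hδdef
  have hδ : 0 < δ := by positivity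
  have hLδ : L * δ ≤ ε / 4 := by
    rw [hδdef, ← mul_div_assoc, div_le_div_iff₀ (by positivity) (by positivity)]; nlinarith
  set η := δ * (ε / 2) with hη
  have hηpos : 0 < η := by positivity
  -- `μ` is the least variation of `Ψ` over an interval of length `η` starting in `[-R, R]`
  have hR0 : 0 ≤ R := (abs_nonneg _).trans (hR 0)
  obtain ⟨u₀, -, hmin⟩ := (isCompact_Icc (a := -R) (b := R)).exists_isMinOn
    (Set.nonempty_Icc.mpr (by linarith)) (f := fun u => Ψ (u + η) - Ψ u) (by fun_prop)
  set μ := Ψ (u₀ + η) - Ψ u₀ with hμ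
  have hμpos : 0 < μ := sub_pos.mpr (hmono (lt_add_of_pos_right _ hηpos))
  have hsep : ∀ u u', |u| ≤ R → |u'| ≤ R → η ≤ |u - u'| → μ ≤ |Ψ u - Ψ u'| := by
    have aux : ∀ u u', |u| ≤ R → u + η ≤ u' → μ ≤ Ψ u' - Ψ u := fun u u' hu huu' => by
      have h1 : μ ≤ Ψ (u + η) - Ψ u := hmin (abs_le.mp hu)
      have h2 := hmono.monotone huu'
      linarith
    intro u u' hu hu' h
    rcases le_abs.mp h with h | h
    · exact (aux u' u hu' (by linarith)).trans (le_abs_self _)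
    · rw [abs_sub_comm]
      exact (aux u u' hu (by linarith)).trans (le_abs_self _)
  have hΨx : ∀ t, HasDerivAt (fun t => Ψ (x t)) (|w (x t)| * y t) t := fun t =>
    (hΨd (x t)).comp t (hx t)
  obtain ⟨T, hT⟩ := Metric.tendsto_atTop.mp h0 (μ / δ) (by positivity)
  refine ⟨T, fun t ht => ?_⟩
  rw [dist_zero_right, Real.norm_eq_abs]
  by_contra hcon
  push Not at hcon
  obtain ⟨s, hs1, hs2, e⟩ := exists_hasDerivAt_eq_add hx t hδ
  obtain ⟨s', hs1', hs2', e'⟩ := exists_hasDerivAt_eq_add hΨx t hδ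
  have h1 : η ≤ |x (t + δ) - x t| := by
    rw [e, abs_mul, abs_of_pos hδ, hη]
    gcongr
    have h2 : |y t - y s| ≤ ε / 4 := (hL t s).trans (le_trans (by
      gcongr
      rw [abs_le]; constructor <;> linarith) hLδ)
    have h3 := abs_sub_abs_le_abs_sub (y t) (y s)
    linarith
  have h2 := hsep _ _ (hR _) (hR _) h1
  rw [e', abs_mul, abs_of_pos hδ, abs_mul, abs_abs, ← abs_mul] at h2
  have h3 := hT s' (ht.le.trans hs1'.le)
  rw [dist_zero_right, Real.norm_eq_abs, lt_div_iff₀ hδ] at h3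
  linarith

/-- A bounded curve along which `Φ` tends to zero converges, if the zeros of `Φ` are isolated. -/
lemma exists_tendsto_of_isolated_zeros {E F : Type*} [MetricSpace E] [ProperSpace E]
    [TopologicalSpace F] [T2Space F] [Zero F] {Φ : E → F} (hΦ : Continuous Φ)
    (hiso : ∀ p, Φ p = 0 → ∀ᶠ p' in 𝓝[≠] p, Φ p' ≠ 0)
    {x : ℝ → E} (hx : Continuous x) {K : Set E} (hK : IsCompact K) (hxK : ∀ t, x t ∈ K)
    (h0 : Tendsto (fun t => Φ (x t)) atTop (𝓝 0)) :
    ∃ p, Φ p = 0 ∧ Tendsto x atTop (𝓝 p) := by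
  have hclus : ∀ p, MapClusterPt p atTop x → Φ p = 0 := fun p hp => by
    have h1 : MapClusterPt (Φ p) atTop (fun t => Φ (x t)) :=
      hp.continuousAt_comp hΦ.continuousAt
    have : ClusterPt (Φ p) (𝓝 (0 : F)) := ClusterPt.mono h1 h0
    exact eq_of_nhds_neBot this
  obtain ⟨p, -, hp⟩ := hK.exists_mapClusterPt (f := atTop) (u := x)
    (tendsto_principal.mpr (Eventually.of_forall hxK))
  refine ⟨p, hclus p hp, ?_⟩
  obtain ⟨ρ, hρ, hball⟩ := Metric.eventually_nhds_iff.mp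
    (eventually_nhdsWithin_iff.mp (hiso p (hclus p hp)))
  rw [Metric.tendsto_nhds]
  intro ε hε
  set r := min ε (ρ / 2) with hr
  have hr0 : 0 < r := by positivity
  -- the curve eventually avoids the sphere of radius `r`, which contains no zero of `Φ`
  have hsph : ∀ᶠ t in atTop, dist (x t) p ≠ r := by
    by_contra hcon
    rw [not_eventually] at hcon
    have hcon' : ∃ᶠ t in atTop, x t ∈ Metric.sphere p r :=
      hcon.mono fun t ht => by simpa using ht
    obtain ⟨p', hp', hcl⟩ := (isCompact_sphere p r).exists_mapClusterPt_of_frequently hcon'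
    have hd : dist p' p = r := hp'
    refine hball (y := p') ?_ ?_ (hclus p' hcl)
    · rw [hd]; exact (min_le_right _ _).trans_lt (by linarith)
    · intro h
      rw [Set.mem_singleton_iff.mp h, dist_self] at hd
      linarith
  obtain ⟨T, hT⟩ := hsph.exists_forall_of_atTop
  have hfreq : ∃ᶠ t in atTop, x t ∈ Metric.ball p r :=
    hp.frequently (Metric.ball_mem_nhds p hr0)
  obtain ⟨t₁, ht₁, ht₁'⟩ := hfreq.forall_exists_of_atTop T
  filter_upwards [eventually_ge_atTop t₁] with t ht
  by_contra hcon
  push Not at hcon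
  have hdc : ContinuousOn (fun t => dist (x t) p) (Set.Icc t₁ t) := by fun_prop
  obtain ⟨s, hs, hs'⟩ := intermediate_value_Icc ht hdc
    ⟨(Metric.mem_ball.mp ht₁').le, (min_le_left _ _).trans hcon⟩
  exact hT s (ht₁.trans hs.1) hs'

/-- `φ` is of class `C^n` on `ℝ`, and all its derivatives of order at most `n` converge at `+∞`. -/
def ConvergesToOrder : ℕ → (ℝ → ℝ) → Prop
  | 0, φ => Continuous φ ∧ ∃ c, Tendsto φ atTop (𝓝 c)
  | n + 1, φ => (∃ c, Tendsto φ atTop (𝓝 c)) ∧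
      ∃ φ', (∀ t, HasDerivAt φ (φ' t) t) ∧ ConvergesToOrder n φ'

namespace ConvergesToOrder

variable {n : ℕ} {φ ψ : ℝ → ℝ}

lemma exists_tendsto (h : ConvergesToOrder n φ) : ∃ c, Tendsto φ atTop (𝓝 c) := by
  cases n with
  | zero => exact h.2
  | succ n => exact h.1

lemma of_succ (h : ConvergesToOrder (n + 1) φ) : ConvergesToOrder n φ := by
  induction n generalizing φ with
  | zero =>
    obtain ⟨hc, φ', hd, -⟩ := h
    exact ⟨continuous_iff_continuousAt.mpr fun t => (hd t).continuousAt, hc⟩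
  | succ n ih =>
    obtain ⟨hc, φ', hd, h'⟩ := h
    exact ⟨hc, φ', hd, ih h'⟩

lemma const (n : ℕ) (c : ℝ) : ConvergesToOrder n fun _ => c := by
  induction n generalizing c with
  | zero => exact ⟨continuous_const, c, tendsto_const_nhds⟩
  | succ n ih => exact ⟨⟨c, tendsto_const_nhds⟩, fun _ => 0, fun t => hasDerivAt_const t c, ih 0⟩

lemma add (h : ConvergesToOrder n φ) (k : ConvergesToOrder n ψ) :
    ConvergesToOrder n fun t => φ t + ψ t := by
  induction n generalizing φ ψ with
  | zero =>
    obtain ⟨hc, c, hl⟩ := h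
    obtain ⟨kc, d, kl⟩ := k
    exact ⟨hc.add kc, c + d, hl.add kl⟩
  | succ n ih =>
    obtain ⟨⟨c, hl⟩, φ', hd, h'⟩ := h
    obtain ⟨⟨d, kl⟩, ψ', kd, k'⟩ := k
    exact ⟨⟨c + d, hl.add kl⟩, _, fun t => (hd t).add (kd t), ih h' k'⟩

lemma mul (h : ConvergesToOrder n φ) (k : ConvergesToOrder n ψ) :
    ConvergesToOrder n fun t => φ t * ψ t := by
  induction n generalizing φ ψ with
  | zero =>
    obtain ⟨hc, c, hl⟩ := h
    obtain ⟨kc, d, kl⟩ := k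
    exact ⟨hc.mul kc, c * d, hl.mul kl⟩
  | succ n ih =>
    have h0 := h.of_succ
    have k0 := k.of_succ
    obtain ⟨⟨c, hl⟩, φ', hd, h'⟩ := h
    obtain ⟨⟨d, kl⟩, ψ', kd, k'⟩ := k
    exact ⟨⟨c * d, hl.mul kl⟩, _, fun t => (hd t).mul (kd t), (ih h' k0).add (ih h0 k')⟩

lemma neg (h : ConvergesToOrder n φ) : ConvergesToOrder n fun t => -φ t := by
  simpa using (const n (-1)).mul h

lemma sub (h : ConvergesToOrder n φ) (k : ConvergesToOrder n ψ) :
    ConvergesToOrder n fun t => φ t - ψ t := by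
  simpa [sub_eq_add_neg] using h.add k.neg

lemma sum {ι : Type*} (s : Finset ι) {F : ι → ℝ → ℝ} (h : ∀ i ∈ s, ConvergesToOrder n (F i)) :
    ConvergesToOrder n fun t => ∑ i ∈ s, F i t := by
  classical
  induction s using Finset.induction_on with
  | empty => simpa using const n 0
  | insert i s hi ih =>
    simp_rw [Finset.sum_insert hi]
    exact (h i (Finset.mem_insert_self i s)).add
      (ih fun j hj => h j (Finset.mem_insert_of_mem hj))

lemma comp {g : ℝ → ℝ} (hg : ContDiff ℝ ∞ g) (h : ConvergesToOrder n φ) :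
    ConvergesToOrder n fun t => g (φ t) := by
  induction n generalizing φ g with
  | zero =>
    obtain ⟨hc, c, hl⟩ := h
    exact ⟨hg.continuous.comp hc, g c, (hg.continuous.tendsto c).comp hl⟩
  | succ n ih =>
    have h0 := h.of_succ
    obtain ⟨⟨c, hl⟩, φ', hd, h'⟩ := h
    have hg' := contDiff_infty_iff_deriv.mp hg
    exact ⟨⟨g c, (hg.continuous.tendsto c).comp hl⟩, fun t => deriv g (φ t) * φ' t,
      fun t => (hg'.1 (φ t)).hasDerivAt.comp t (hd t), (ih hg'.2 h0).mul h'⟩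

lemma contDiff (h : ConvergesToOrder n φ) : ContDiff ℝ n φ := by
  induction n generalizing φ with
  | zero => exact contDiff_zero.mpr h.1
  | succ n ih =>
    obtain ⟨-, φ', hd, h'⟩ := h
    have e : deriv φ = φ' := funext fun t => (hd t).deriv
    push_cast
    rw [contDiff_succ_iff_deriv]
    exact ⟨fun t => (hd t).differentiableAt, by simp, e ▸ ih h'⟩

lemma tendsto_iteratedDeriv (h : ConvergesToOrder n φ) {l : ℕ} (hl : 1 ≤ l) (hn : l ≤ n) :
    Tendsto (iteratedDeriv l φ) atTop (𝓝 0) := by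
  induction n generalizing φ l with
  | zero => omega
  | succ n ih =>
    obtain ⟨⟨c, hc⟩, φ', hd, h'⟩ := h
    have e : deriv φ = φ' := funext fun t => (hd t).deriv
    obtain ⟨l, rfl⟩ : ∃ k, l = k + 1 := ⟨l - 1, by omega⟩
    rw [iteratedDeriv_succ', e]
    rcases Nat.eq_zero_or_pos l with rfl | hl'
    · obtain ⟨c', hc'⟩ := h'.exists_tendsto
      rw [iteratedDeriv_zero]
      exact eq_zero_of_tendsto_hasDerivAt hd hc hc' ▸ hc'
    · exact ih h' hl' (by omega)

end ConvergesToOrder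

/-! ### Continuity of observables, form factors, and the gradient of the effective potential -/

section bathAmp

variable {f : ℝ → ℝ} {z : ℝ → ℂ} {v : ℝ → ℝ}

lemma continuous_integral_mul_bathAmp (hf : MemLp f 2) (hz : MemLp z 2) (hv : Continuous v)
    {g : ℝ → ℝ} (hg : MemLp g 2) :
    Continuous fun t => ∫ ν, (g ν : ℂ) * bathAmp f z v t ν := by
  have hgC : MemLp (fun ν => (g ν : ℂ)) 2 := hg.ofReal
  refine continuous_iff_continuousAt.mpr fun t => ?_
  obtain ⟨B, hB0, hB⟩ := exists_drive_bound hv (|t| + 1)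
  have hnear : ∀ᶠ s in 𝓝 t, |s| ≤ |t| + 1 :=
    (continuous_abs.tendsto t).eventually_le_const (lt_add_one _)
  refine continuousAt_of_dominated (bound := fun ν => ‖g ν‖ * (‖z ν‖ + B * |f ν|))
    (Eventually.of_forall fun s => hgC.1.mul (aestronglyMeasurable_bathAmp hf hz hv s)) ?_
    (hg.norm.integrable_mul (hz.norm.add (hf.norm.const_mul B))) ?_
  · filter_upwards [hnear] with s hs
    refine Eventually.of_forall fun ν => ?_
    rw [norm_mul, Complex.norm_real]
    gcongr
    exact norm_bathAmp_le ((hB s hs).2 ν)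
  · exact Eventually.of_forall fun ν =>
      ((hasDerivAt_bathAmp hv ν t).continuousAt).const_mul _

/-- A crude form of the Cauchy–Schwarz inequality. -/
lemma norm_integral_mul_bathAmp_le (hf : MemLp f 2) (hz : MemLp z 2) (hv : Continuous v)
    {g : ℝ → ℝ} (hg : MemLp g 2) (t : ℝ) :
    ‖∫ ν, (g ν : ℂ) * bathAmp f z v t ν‖
      ≤ (∫ ν, ‖g ν‖ ^ 2) + ∫ ν, ‖bathAmp f z v t ν‖ ^ 2 := by
  have h1 := hg.integrable_norm_pow two_ne_zero
  have h2 := (memLp_bathAmp hf hz hv t).integrable_norm_pow two_ne_zero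
  rw [← integral_add h1 h2]
  refine norm_integral_le_of_norm_le (h1.add h2) (Eventually.of_forall fun ν => ?_)
  rw [norm_mul, Complex.norm_real]
  nlinarith [sq_nonneg (‖g ν‖ - ‖bathAmp f z v t ν‖), sq_nonneg ‖g ν‖,
    sq_nonneg ‖bathAmp f z v t ν‖]

end bathAmp

section formFactor

/-- The form factor `κ(ν) / ν` with which a thermostat responds to a velocity; its value at the
origin is `0` by the convention for division, and immaterial. -/
noncomputable def formFactor (κ : ℝ → ℝ) (ν : ℝ) : ℝ := κ ν / ν

variable {κ : ℝ → ℝ}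

lemma mul_formFactor (h0 : κ 0 = 0) (ν : ℝ) : ν * formFactor κ ν = κ ν := by
  by_cases h : ν = 0
  · simp [h, h0]
  · rw [formFactor]; field_simp

lemma memLp_formFactor (hκ : ContDiff ℝ 2 κ) (h0 : κ 0 = 0) (h2 : MemLp κ 2) :
    MemLp (formFactor κ) 2 := by
  have hd : DifferentiableAt ℝ κ 0 := hκ.differentiable two_ne_zero 0
  obtain ⟨C, hC⟩ := hd.isBigO_sub.bound
  obtain ⟨δ, hδ, hball⟩ := Metric.eventually_nhds_iff.mp hC
  have hC0 : 0 ≤ C := by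
    by_contra hneg
    have h3 := hball (y := δ / 2) (by rw [Real.dist_eq, sub_zero, abs_of_pos] <;> linarith)
    rw [h0, sub_zero, sub_zero, Real.norm_eq_abs (δ / 2), abs_of_pos (half_pos hδ)] at h3
    have := norm_nonneg (κ (δ / 2))
    nlinarith
  have hm1 : MemLp ((Metric.ball (0 : ℝ) δ).indicator fun _ => C) 2 :=
    memLp_indicator_const 2 measurableSet_ball C (Or.inr measure_ball_lt_top.ne)
  have hm2 : MemLp (fun ν => δ⁻¹ * ‖κ ν‖) 2 := h2.norm.const_mul _
  refine (hm1.add hm2).mono (hκ.continuous.measurable.div measurable_id).aestronglyMeasurable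
    (Eventually.of_forall fun ν => ?_)
  refine le_trans ?_ (le_abs_self _)
  rw [formFactor, norm_div, Pi.add_apply]
  by_cases hν : ν ∈ Metric.ball (0 : ℝ) δ
  · rw [Set.indicator_of_mem hν]
    have h3 := hball (y := ν) hν
    rw [h0, sub_zero, sub_zero] at h3
    have h4 : ‖κ ν‖ / ‖ν‖ ≤ C := div_le_of_le_mul₀ (norm_nonneg _) hC0 h3
    have : 0 ≤ δ⁻¹ * ‖κ ν‖ := by positivity
    linarith
  · rw [Set.indicator_of_notMem hν, zero_add]
    have h3 : δ ≤ ‖ν‖ := by simpa using hν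
    rw [div_eq_inv_mul]
    gcongr

lemma continuousOn_formFactor (hκ : ContDiff ℝ 2 κ) : ContinuousOn (formFactor κ) {0}ᶜ :=
  hκ.continuous.continuousOn.div continuousOn_id fun _ h => h

lemma formFactor_ne_zero (h0 : ∀ ν, κ ν = 0 ↔ ν = 0) : ∀ ν ≠ 0, formFactor κ ν ≠ 0 :=
  fun ν hν => div_ne_zero (fun h => hν ((h0 ν).mp h)) hν

lemma memLp_pow_mul {r k : ℕ} (hk : k ≤ r) (h2 : MemLp κ 2)
    (hr : MemLp (fun ν => ν ^ r * κ ν) 2) : MemLp (fun ν => ν ^ k * κ ν) 2 := by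
  refine (h2.norm.add hr.norm).mono
    ((by fun_prop : Continuous fun ν : ℝ => ν ^ k).aestronglyMeasurable.mul h2.1)
    (Eventually.of_forall fun ν => ?_)
  refine le_trans ?_ (le_abs_self _)
  simp only [Pi.add_apply, norm_mul, norm_pow]
  have h3 : ‖ν‖ ^ k ≤ 1 + ‖ν‖ ^ r := by
    rcases le_total ‖ν‖ 1 with h | h
    · have := pow_le_one₀ (n := k) (norm_nonneg ν) h
      have : 0 ≤ ‖ν‖ ^ r := by positivity
      linarith
    · have := pow_le_pow_right₀ h hk
      linarith
  calc ‖ν‖ ^ k * ‖κ ν‖ ≤ (1 + ‖ν‖ ^ r) * ‖κ ν‖ := by gcongr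
    _ = _ := by ring

end formFactor

/-- Bounded and globally Lipschitz functions on `ℝ`. -/
def BddLip (φ : ℝ → ℝ) : Prop :=
  ∃ C L, (∀ t, |φ t| ≤ C) ∧ ∀ s t, |φ s - φ t| ≤ L * |s - t|

namespace BddLip

variable {φ ψ : ℝ → ℝ}

lemma const (c : ℝ) : BddLip fun _ => c := ⟨|c|, 0, fun _ => le_rfl, fun _ _ => by simp⟩

lemma add (h : BddLip φ) (k : BddLip ψ) : BddLip fun t => φ t + ψ t := by
  obtain ⟨C, L, hC, hL⟩ := h
  obtain ⟨D, M, hD, hM⟩ := k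
  refine ⟨C + D, L + M, fun t => (abs_add_le _ _).trans (add_le_add (hC t) (hD t)), fun s t => ?_⟩
  rw [add_sub_add_comm, add_mul]
  exact (abs_add_le _ _).trans (add_le_add (hL s t) (hM s t))

lemma mul (h : BddLip φ) (k : BddLip ψ) : BddLip fun t => φ t * ψ t := by
  obtain ⟨C, L, hC, hL⟩ := h
  obtain ⟨D, M, hD, hM⟩ := k
  have hC0 : 0 ≤ C := (abs_nonneg _).trans (hC 0)
  have hD0 : 0 ≤ D := (abs_nonneg _).trans (hD 0)
  refine ⟨C * D, C * M + L * D, fun t => ?_, fun s t => ?_⟩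
  · rw [abs_mul]; exact mul_le_mul (hC t) (hD t) (abs_nonneg _) hC0
  · rw [show φ s * ψ s - φ t * ψ t = φ s * (ψ s - ψ t) + (φ s - φ t) * ψ t by ring]
    refine (abs_add_le _ _).trans ?_
    rw [abs_mul, abs_mul, add_mul]
    refine add_le_add ?_ ?_
    · rw [mul_assoc]
      exact mul_le_mul (hC s) (hM s t) (abs_nonneg _) hC0
    · rw [mul_right_comm]
      exact mul_le_mul (hL s t) (hD t) (abs_nonneg _) ((abs_nonneg _).trans (hL s t))

lemma neg (h : BddLip φ) : BddLip fun t => -φ t := by simpa using (const (-1)).mul h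

lemma sub (h : BddLip φ) (k : BddLip ψ) : BddLip fun t => φ t - ψ t := by
  simpa [sub_eq_add_neg] using h.add k.neg

lemma sum {ι : Type*} (s : Finset ι) {F : ι → ℝ → ℝ} (h : ∀ i ∈ s, BddLip (F i)) :
    BddLip fun t => ∑ i ∈ s, F i t := by
  classical
  induction s using Finset.induction_on with
  | empty => simpa using const 0
  | insert i s hi ih =>
    simp_rw [Finset.sum_insert hi]
    exact (h i (Finset.mem_insert_self i s)).add
      (ih fun j hj => h j (Finset.mem_insert_of_mem hj))

lemma comp {g : ℝ → ℝ} (hg : ContDiff ℝ ∞ g) (h : BddLip φ) : BddLip fun t => g (φ t) := by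
  obtain ⟨C, L, hC, hL⟩ := h
  have hg' := contDiff_infty_iff_deriv.mp hg
  obtain ⟨A, hA⟩ := (isCompact_Icc (a := -C) (b := C)).exists_bound_of_continuousOn
    hg.continuous.continuousOn
  obtain ⟨D, hD⟩ := (isCompact_Icc (a := -C) (b := C)).exists_bound_of_continuousOn
    hg'.2.continuous.continuousOn
  have hD0 : 0 ≤ D := (norm_nonneg _).trans (hD _ (abs_le.mp (hC 0)))
  refine ⟨A, D * L, fun t => hA _ (abs_le.mp (hC t)), fun s t => ?_⟩
  have h1 := (convex_Icc (-C) C).norm_image_sub_le_of_norm_deriv_le (f := g)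
    (fun x _ => hg'.1 x) hD (abs_le.mp (hC t)) (abs_le.mp (hC s))
  refine h1.trans ?_
  rw [mul_assoc]
  exact mul_le_mul_of_nonneg_left (hL s t) hD0

lemma of_hasDerivAt {C D : ℝ} (hφ : ∀ t, |φ t| ≤ C) (hd : ∀ t, HasDerivAt φ (ψ t) t)
    (hψ : ∀ t, |ψ t| ≤ D) : BddLip φ :=
  ⟨C, D, hφ, abs_sub_le_of_hasDerivAt hd hψ⟩

lemma exists_bound (h : BddLip φ) : ∃ C, ∀ t, |φ t| ≤ C := by
  obtain ⟨C, L, hC, hL⟩ := h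
  exact ⟨C, hC⟩

lemma tendsto_mul (h : BddLip φ) (hψ : Tendsto ψ atTop (𝓝 0)) :
    Tendsto (fun t => φ t * ψ t) atTop (𝓝 0) := by
  obtain ⟨C, hC⟩ := h.exists_bound
  refine squeeze_zero_norm (a := fun t => C * |ψ t|) (fun t => ?_) ?_
  · rw [norm_mul]
    exact mul_le_mul_of_nonneg_right (hC t) (norm_nonneg _)
  · simpa using hψ.abs.const_mul C

end BddLip

namespace OscillatorNetwork

lemma deriv_V_symm {G : Type*} {N : OscillatorNetwork G} {i j : G} (h : N.graph.Adj i j) (x : ℝ) :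
    deriv (N.V i j) x = -deriv (N.V j i) (-x) := by
  have : N.V i j = fun x => N.V j i (-x) := funext (N.V_symm i j h)
  rw [this, deriv_comp_neg]

variable {G : Type*} [Fintype G]

open Classical in
/-- The partial derivative of the effective potential at `q` in the direction of the vertex `j`. -/
noncomputable def grad (N : OscillatorNetwork G) (q : G → ℝ) (j : G) : ℝ :=
  deriv (N.U j) (q j) - (∑ i, if N.graph.Adj i j then deriv (N.V i j) (q i - q j) else 0)
    - if j ∈ N.thermo then N.K j * q j else 0

variable {N : OscillatorNetwork G}

lemma hasFDerivAt_Veff (hA1 : N.A1) (q : G → ℝ) :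
    HasFDerivAt N.Veff
      (∑ j, N.grad q j • (ContinuousLinearMap.proj j : (G → ℝ) →L[ℝ] ℝ)) q := by
  classical
  have hp : ∀ j, HasFDerivAt (fun q : G → ℝ => q j)
      (ContinuousLinearMap.proj j : (G → ℝ) →L[ℝ] ℝ) q := fun j => hasFDerivAt_apply j q
  have hU : ∀ j, HasFDerivAt (fun q : G → ℝ => N.U j (q j))
      (deriv (N.U j) (q j) • (ContinuousLinearMap.proj j : (G → ℝ) →L[ℝ] ℝ)) q := fun j =>
    (((hA1.1 j).differentiable (by simp)) (q j)).hasDerivAt.comp_hasFDerivAt q (hp j)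
  have hV : ∀ i j, HasFDerivAt (fun q : G → ℝ => if N.graph.Adj i j then N.V i j (q i - q j) else 0)
      (if N.graph.Adj i j then deriv (N.V i j) (q i - q j) •
        ((ContinuousLinearMap.proj i : (G → ℝ) →L[ℝ] ℝ) - ContinuousLinearMap.proj j) else 0) q := by
    intro i j
    split_ifs with h
    · exact ((((hA1.2 i j h).1).differentiable (by simp)) (q i - q j)).hasDerivAt.comp_hasFDerivAt q
        ((hp i).sub (hp j))
    · exact hasFDerivAt_const 0 q
  have hK : ∀ m, HasFDerivAt (fun q : G → ℝ => N.K m * (q m) ^ 2 / 2)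
      ((N.K m * q m) • (ContinuousLinearMap.proj m : (G → ℝ) →L[ℝ] ℝ)) q := fun m => by
    have h1 : HasDerivAt (fun x : ℝ => N.K m * x ^ 2 / 2) (N.K m * q m) (q m) := by
      refine (((hasDerivAt_pow 2 (q m)).const_mul (N.K m)).div_const 2).congr_deriv ?_
      simp; ring
    exact h1.comp_hasFDerivAt q (hp m)
  have key := ((HasFDerivAt.fun_sum fun j (_ : j ∈ Finset.univ) => hU j).add
    ((HasFDerivAt.fun_sum fun i (_ : i ∈ Finset.univ) =>
      HasFDerivAt.fun_sum fun j (_ : j ∈ Finset.univ) => hV i j).const_mul (1 / 2))).sub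
    (HasFDerivAt.fun_sum fun m (_ : m ∈ N.thermo) => hK m)
  refine key.congr_fderiv ?_
  ext w
  -- by the symmetry of the interactions, the two halves of each pair sum agree
  have hsym : ∑ i, ∑ j, (if N.graph.Adj i j then deriv (N.V i j) (q i - q j) * w i else 0)
      = -∑ j, ∑ i, (if N.graph.Adj i j then deriv (N.V i j) (q i - q j) * w j else 0) := by
    rw [← Finset.sum_neg_distrib]
    refine Finset.sum_congr rfl fun i _ => ?_
    rw [← Finset.sum_neg_distrib]
    refine Finset.sum_congr rfl fun j _ => ?_
    by_cases h : N.graph.Adj i j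
    · rw [if_pos h, if_pos h.symm, deriv_V_symm h, neg_sub, neg_mul]
    · rw [if_neg h, if_neg fun h' => h h'.symm, neg_zero]
  have hsplit : ∑ i, ∑ j, (if N.graph.Adj i j then deriv (N.V i j) (q i - q j) * (w i - w j) else 0)
      = -2 * ∑ j, ∑ i, (if N.graph.Adj i j then deriv (N.V i j) (q i - q j) * w j else 0) := by
    have e : ∀ i j, (if N.graph.Adj i j then deriv (N.V i j) (q i - q j) * (w i - w j) else 0)
        = (if N.graph.Adj i j then deriv (N.V i j) (q i - q j) * w i else 0)
          - (if N.graph.Adj i j then deriv (N.V i j) (q i - q j) * w j else 0) := fun i j => by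
      split_ifs <;> ring
    simp_rw [e, Finset.sum_sub_distrib]
    rw [hsym, Finset.sum_comm (f := fun i j =>
      if N.graph.Adj i j then deriv (N.V i j) (q i - q j) * w j else 0)]
    ring
  have happ : ∀ i j, (if N.graph.Adj i j then deriv (N.V i j) (q i - q j) •
        ((ContinuousLinearMap.proj i : (G → ℝ) →L[ℝ] ℝ) - ContinuousLinearMap.proj j)
        else 0 : (G → ℝ) →L[ℝ] ℝ) w
      = if N.graph.Adj i j then deriv (N.V i j) (q i - q j) * (w i - w j) else 0 := fun i j => by
    split_ifs <;> simp
  simp only [sub_apply, add_apply,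
    sum_apply, smul_apply, happ, hsplit,
    ContinuousLinearMap.proj_apply, smul_eq_mul, grad, sub_mul, Finset.sum_sub_distrib,
    Finset.sum_mul, ite_mul, zero_mul]
  rw [Finset.sum_ite_mem, Finset.univ_inter]
  ring

lemma mem_critSet_iff (hA1 : N.A1) (q : G → ℝ) : q ∈ N.critSet ↔ N.grad q = 0 := by
  classical
  have h : ∀ j, fderiv ℝ N.Veff q (Pi.single j 1) = N.grad q j := fun j => by
    rw [(hasFDerivAt_Veff hA1 q).fderiv]
    simp [Pi.single_apply]
  constructor
  · intro hq
    ext j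
    rw [← h j]
    convert! hq j
  · intro hq j
    have := h j
    rw [hq] at this
    convert! this

lemma continuous_Veff (hA1 : N.A1) : Continuous N.Veff :=
  continuous_iff_continuousAt.mpr fun q => (hasFDerivAt_Veff hA1 q).continuousAt

lemma continuous_grad (hA1 : N.A1) : Continuous N.grad := by
  refine continuous_pi fun j => ?_
  have h1 : Continuous (deriv (N.U j)) := (contDiff_infty_iff_deriv.mp (hA1.1 j)).2.continuous
  refine ((h1.comp (continuous_apply j)).sub (continuous_finsetSum _ fun i _ => ?_)).sub ?_
  · split_ifs with h
    · have h2 : Continuous (deriv (N.V i j)) :=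
        (contDiff_infty_iff_deriv.mp (hA1.2 i j h).1).2.continuous
      exact h2.comp ((continuous_apply i).sub (continuous_apply j))
    · exact continuous_const
  · split_ifs
    · exact (continuous_apply j).const_mul _
    · exact continuous_const

end OscillatorNetwork

/-! ### The closed equations of motion of the oscillators -/

namespace OscillatorNetwork

section

variable {G : Type*} {N : OscillatorNetwork G} {r : ℕ} {m : G}

lemma A2.memLp_κ (hA2 : N.A2 r) (hm : m ∈ N.thermo) : MemLp (N.κ m) 2 := (hA2 m hm).2.2.2.1

lemma A2.memLp (hA2 : N.A2 r) (hm : m ∈ N.thermo) : MemLp (formFactor (N.κ m)) 2 :=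
  memLp_formFactor (hA2 m hm).1 (((hA2 m hm).2.1 0).mpr rfl) (hA2 m hm).2.2.2.1

lemma A2.mul_formFactor (hA2 : N.A2 r) (hm : m ∈ N.thermo) (ν : ℝ) :
    ν * formFactor (N.κ m) ν = N.κ m ν :=
  _root_.mul_formFactor (((hA2 m hm).2.1 0).mpr rfl) ν

lemma A2.memLp_pow_mul (hA2 : N.A2 r) (hm : m ∈ N.thermo) {k : ℕ} (hk : k ≤ r) :
    MemLp (fun ν => ν ^ k * N.κ m ν) 2 :=
  _root_.memLp_pow_mul hk (hA2 m hm).2.2.2.1 (hA2 m hm).2.2.2.2.2.2.1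

lemma K_eq_integral_formFactor : N.K m = ∫ ν, formFactor (N.κ m) ν * formFactor (N.κ m) ν := by
  simp_rw [K, formFactor, ← div_pow, sq]

end

variable {G : Type*} [Fintype G]

/-- The observable `∫ g Z_m` of the thermostat at the vertex `m`, where `Z_m` is the amplitude with
initial value `z m`, driven by the velocity of that vertex. -/
noncomputable def observable (N : OscillatorNetwork G) (z : G → ℝ → ℂ) (v : G → ℝ → ℝ) (g : ℝ → ℝ)
    (m : G) (t : ℝ) : ℂ :=
  ∫ ν, (g ν : ℂ) * bathAmp (formFactor (N.κ m)) (z m) (v m) t ν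

open Classical in
/-- The force exerted on the vertex `j` by its thermostat, apart from the part absorbed into the
effective potential. -/
noncomputable def bathForce (N : OscillatorNetwork G) (z : G → ℝ → ℂ) (v : G → ℝ → ℝ)
    (j : G) (t : ℝ) : ℝ :=
  if j ∈ N.thermo then (N.observable z v (formFactor (N.κ j)) j t).im else 0

/-- The closed equations of motion of the oscillators, obtained by solving for the thermostats. -/
structure IsReducedSolution (N : OscillatorNetwork G) (z : G → ℝ → ℂ) (q v : G → ℝ → ℝ) : Prop where
  memLp : ∀ m ∈ N.thermo, MemLp (z m) 2
  q_deriv : ∀ j t, HasDerivAt (q j) (v j t) t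
  v_deriv : ∀ j t, HasDerivAt (v j) (-N.grad (fun i => q i t) j + N.bathForce z v j t) t

variable {N : OscillatorNetwork G} {r : ℕ} {m : G}

namespace IsReducedSolution

variable {z : G → ℝ → ℂ} {q v : G → ℝ → ℝ}

lemma continuous_q (h : N.IsReducedSolution z q v) (j : G) : Continuous (q j) :=
  continuous_iff_continuousAt.mpr fun t => (h.q_deriv j t).continuousAt

lemma continuous_v (h : N.IsReducedSolution z q v) (j : G) : Continuous (v j) :=
  continuous_iff_continuousAt.mpr fun t => (h.v_deriv j t).continuousAt

lemma hasDerivAt_curve (h : N.IsReducedSolution z q v) (t : ℝ) :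
    HasDerivAt (fun t i => q i t) (fun i => v i t) t :=
  hasDerivAt_pi.mpr fun i => h.q_deriv i t

lemma continuous_curve (h : N.IsReducedSolution z q v) : Continuous fun t i => q i t :=
  continuous_pi fun i => h.continuous_q i

/-- Conservation of energy. -/
lemma energy_eq (h : N.IsReducedSolution z q v) (hA1 : N.A1) (hA2 : N.A2 r) (t : ℝ) :
    ∑ j, (v j t) ^ 2 / 2 + N.Veff (fun i => q i t)
      + ∑ m ∈ N.thermo, (1 / 2) * ∫ ν, ‖bathAmp (formFactor (N.κ m)) (z m) (v m) t ν‖ ^ 2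
    = ∑ j, (v j 0) ^ 2 / 2 + N.Veff (fun i => q i 0)
      + ∑ m ∈ N.thermo, (1 / 2) * ∫ ν, ‖z m ν‖ ^ 2 := by
  classical
  have hd : ∀ t, HasDerivAt (fun t => ∑ j, (v j t) ^ 2 / 2 + N.Veff (fun i => q i t)
      + ∑ m ∈ N.thermo, (1 / 2) * ∫ ν, ‖bathAmp (formFactor (N.κ m)) (z m) (v m) t ν‖ ^ 2) 0 t := by
    intro t
    have h1 := HasDerivAt.fun_sum fun j (_ : j ∈ Finset.univ) =>
      ((h.v_deriv j t).pow 2).div_const 2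
    have h2 := (hasFDerivAt_Veff hA1 (fun i => q i t)).comp_hasDerivAt t (h.hasDerivAt_curve t)
    have h3 := HasDerivAt.fun_sum fun m (hm : m ∈ N.thermo) =>
      (hasDerivAt_integral_normSq_bathAmp (hA2.memLp hm) (h.memLp m hm)
        (h.continuous_v m) t).const_mul (1 / 2)
    refine ((h1.add h2).add h3).congr_deriv ?_
    have e : ∀ j, v j t * N.bathForce z v j t = if j ∈ N.thermo then
        v j t * (N.observable z v (formFactor (N.κ j)) j t).im else 0 := fun j => by
      rw [bathForce]; split_ifs <;> simp
    have e2 : ∑ j, v j t * N.bathForce z v j t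
        = ∑ j ∈ N.thermo, v j t * (N.observable z v (formFactor (N.κ j)) j t).im := by
      simp_rw [e]
      rw [Finset.sum_ite_mem, Finset.univ_inter]
    have e3 : ∑ j ∈ N.thermo, 1 / 2 * (-2 * v j t *
        (∫ ν, (formFactor (N.κ j) ν : ℂ) * bathAmp (formFactor (N.κ j)) (z j) (v j) t ν).im)
        = -∑ j, v j t * N.bathForce z v j t := by
      rw [e2, ← Finset.sum_neg_distrib]
      refine Finset.sum_congr rfl fun j _ => ?_
      rw [observable]; ring
    rw [e3]
    simp only [sum_apply, smul_apply, ContinuousLinearMap.proj_apply, smul_eq_mul]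
    rw [← Finset.sum_add_distrib, ← sub_eq_add_neg, ← Finset.sum_sub_distrib]
    refine Finset.sum_eq_zero fun j _ => ?_
    simp; ring
  have := is_const_of_deriv_eq_zero (fun t => (hd t).differentiableAt)
    (fun t => (hd t).deriv) t 0
  simpa only [bathAmp_zero] using this

/-- Energy bounds: positions, velocities and bath amplitudes stay bounded for all times. -/
lemma exists_bounds (h : N.IsReducedSolution z q v) (hA1 : N.A1) (hA2 : N.A2 r) (hA3 : N.A3) :
    ∃ B C M : ℝ, (∀ j t, |q j t| ≤ B) ∧ (∀ j t, |v j t| ≤ C) ∧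
      ∀ m ∈ N.thermo, ∀ t, ∫ ν, ‖bathAmp (formFactor (N.κ m)) (z m) (v m) t ν‖ ^ 2 ≤ M := by
  set H := ∑ j, (v j 0) ^ 2 / 2 + N.Veff (fun i => q i 0)
      + ∑ m ∈ N.thermo, (1 / 2) * ∫ ν, ‖z m ν‖ ^ 2 with hH
  have hE := h.energy_eq hA1 hA2
  have hv0 : ∀ t, 0 ≤ ∑ j, (v j t) ^ 2 / 2 := fun t => Finset.sum_nonneg fun j _ => by positivity
  have hZ0 : ∀ t m, 0 ≤ (1 / 2) *
      ∫ ν, ‖bathAmp (formFactor (N.κ m)) (z m) (v m) t ν‖ ^ 2 := fun t m =>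
    mul_nonneg (by norm_num) (integral_nonneg fun ν => by positivity)
  have hZs : ∀ t, 0 ≤ ∑ m ∈ N.thermo, (1 / 2) *
      ∫ ν, ‖bathAmp (formFactor (N.κ m)) (z m) (v m) t ν‖ ^ 2 := fun t =>
    Finset.sum_nonneg fun m _ => hZ0 t m
  obtain ⟨S, hS, hSsub⟩ := mem_cocompact.mp (hA3.eventually_gt_atTop H)
  have hqS : ∀ t, (fun i => q i t) ∈ S := fun t => by
    by_contra hcon
    have h1 : H < N.Veff (fun i => q i t) := hSsub hcon
    linarith [hE t, hv0 t, hZs t]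
  obtain ⟨B, hB⟩ := hS.exists_bound_of_continuousOn (f := fun x : G → ℝ => x) continuousOn_id
  obtain ⟨D, hD⟩ := hS.exists_bound_of_continuousOn (continuous_Veff hA1).continuousOn
  have hD' : ∀ t, -D ≤ N.Veff (fun i => q i t) := fun t => (abs_le.mp (hD _ (hqS t))).1
  refine ⟨B, Real.sqrt (2 * (H + D)), 2 * (H + D), fun j t => ?_, fun j t => ?_, fun m hm t => ?_⟩
  · exact (norm_le_pi_norm (fun i => q i t) j).trans (hB _ (hqS t))
  · apply Real.abs_le_sqrt
    have h1 := Finset.single_le_sum (f := fun j => (v j t) ^ 2 / 2) (s := Finset.univ)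
      (fun j _ => by positivity) (Finset.mem_univ j)
    linarith [hE t, hZs t, hD' t]
  · have h1 := Finset.single_le_sum (f := fun m => (1 / 2) *
      ∫ ν, ‖bathAmp (formFactor (N.κ m)) (z m) (v m) t ν‖ ^ 2) (s := N.thermo)
      (fun m _ => hZ0 t m) hm
    linarith [hE t, hv0 t, hD' t]

lemma bddLip_grad (hA1 : N.A1) (hq : ∀ j, BddLip (q j)) (j : G) :
    BddLip fun t => N.grad (fun i => q i t) j := by
  classical
  refine ((BddLip.comp (contDiff_infty_iff_deriv.mp (hA1.1 j)).2 (hq j)).sub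
    (BddLip.sum _ fun i _ => ?_)).sub ?_
  · split_ifs with hij
    · exact BddLip.comp (contDiff_infty_iff_deriv.mp (hA1.2 i j hij).1).2 ((hq i).sub (hq j))
    · exact BddLip.const 0
  · split_ifs
    · exact (BddLip.const _).mul (hq j)
    · exact BddLip.const 0

lemma bddLip (h : N.IsReducedSolution z q v) (hA1 : N.A1) (hA2 : N.A2 r) (hA3 : N.A3) (j : G) :
    BddLip (q j) ∧ BddLip (v j) := by
  classical
  obtain ⟨B, C, M, hB, hC, hM⟩ := h.exists_bounds hA1 hA2 hA3
  have hq : ∀ j, BddLip (q j) := fun j => BddLip.of_hasDerivAt (hB j) (h.q_deriv j) (hC j)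
  refine ⟨hq j, ?_⟩
  obtain ⟨D, hD⟩ := (bddLip_grad hA1 hq j).exists_bound
  obtain ⟨D', hD'⟩ : ∃ D', ∀ t, |N.bathForce z v j t| ≤ D' := by
    by_cases hj : j ∈ N.thermo
    · refine ⟨(∫ ν, ‖formFactor (N.κ j) ν‖ ^ 2) + M, fun t => ?_⟩
      rw [bathForce, if_pos hj]
      refine (Complex.abs_im_le_norm _).trans ((norm_integral_mul_bathAmp_le (hA2.memLp hj)
        (h.memLp j hj) (h.continuous_v j) (hA2.memLp hj) t).trans ?_)
      gcongr
      exact hM j hj t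
    · exact ⟨0, fun t => by simp [bathForce, hj]⟩
  refine BddLip.of_hasDerivAt (D := D + D') (hC j) (h.v_deriv j) fun t => ?_
  refine (abs_add_le _ _).trans (add_le_add ?_ (hD' t))
  rw [abs_neg]; exact hD t

/-- A vertex that carries a thermostat comes to rest. -/
lemma tendsto_v_of_mem_thermo (h : N.IsReducedSolution z q v) (hA1 : N.A1) (hA2 : N.A2 r)
    (hA3 : N.A3) (hm : m ∈ N.thermo) : Tendsto (v m) atTop (𝓝 0) := by
  obtain ⟨B, C, M, hB, hC, hM⟩ := h.exists_bounds hA1 hA2 hA3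
  obtain ⟨-, -, L, -, hL⟩ := h.bddLip hA1 hA2 hA3 m
  exact tendsto_zero_of_bathAmp_bounded (hA2.memLp hm) (continuousOn_formFactor (hA2 m hm).1)
    (formFactor_ne_zero (hA2 m hm).2.1) (h.memLp m hm) (h.continuous_v m) (hM m hm) (hC m) hL
    (h.q_deriv m) (hB m)

lemma tendsto_observable (h : N.IsReducedSolution z q v) (hA1 : N.A1) (hA2 : N.A2 r)
    (hA3 : N.A3) (hm : m ∈ N.thermo) {g : ℝ → ℝ} (hg : MemLp g 2) :
    Tendsto (N.observable z v g m) atTop (𝓝 0) := by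
  obtain ⟨B, C, M, hB, hC, hM⟩ := h.exists_bounds hA1 hA2 hA3
  exact tendsto_integral_mul_bathAmp (hA2.memLp hm) (continuousOn_formFactor (hA2 m hm).1)
    (formFactor_ne_zero (hA2 m hm).2.1) (h.memLp m hm) (h.continuous_v m) (hM m hm) (hC m)
    (h.tendsto_v_of_mem_thermo hA1 hA2 hA3 hm) hg

lemma tendsto_bathForce (h : N.IsReducedSolution z q v) (hA1 : N.A1) (hA2 : N.A2 r)
    (hA3 : N.A3) (j : G) : Tendsto (N.bathForce z v j) atTop (𝓝 0) := by
  by_cases hj : j ∈ N.thermo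
  · have := (Complex.continuous_im.tendsto 0).comp
      (h.tendsto_observable hA1 hA2 hA3 hj (hA2.memLp hj))
    refine this.congr fun t => ?_
    simp [bathForce, hj]
  · refine tendsto_const_nhds.congr fun t => ?_
    simp [bathForce, hj]

lemma hasDerivAt_observable (h : N.IsReducedSolution z q v) (hA2 : N.A2 r) (hm : m ∈ N.thermo)
    {g g' : ℝ → ℝ} (hg : MemLp g 2) (hg' : MemLp g' 2) (e : ∀ ν, ν * g ν = g' ν) (t : ℝ) :
    HasDerivAt (N.observable z v g m)
      (Complex.I * N.observable z v g' m t
        - Complex.I * v m t * ((∫ ν, formFactor (N.κ m) ν * g ν : ℝ) : ℂ)) t := by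
  obtain rfl : (fun ν => ν * g ν) = g' := funext e
  exact hasDerivAt_integral_bathAmp (hA2.memLp hm) (h.memLp m hm) (h.continuous_v m) hg hg' t

lemma hasDerivAt_bathForce (h : N.IsReducedSolution z q v) (hA2 : N.A2 r) (hm : m ∈ N.thermo)
    (t : ℝ) :
    HasDerivAt (N.bathForce z v m) ((N.observable z v (N.κ m) m t).re - N.K m * v m t) t := by
  have h1 := h.hasDerivAt_observable hA2 hm (hA2.memLp hm) (hA2.memLp_κ hm)
    (hA2.mul_formFactor hm) t
  have h2 := (Complex.imCLM.hasFDerivAt).comp_hasDerivAt t h1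
  have e : N.bathForce z v m = fun t => (N.observable z v (formFactor (N.κ m)) m t).im :=
    funext fun t => by simp [bathForce, hm]
  rw [e]
  refine h2.congr_deriv ?_
  rw [← K_eq_integral_formFactor]
  simp; ring

end IsReducedSolution

end OscillatorNetwork

/-! ### Relaxation of the network -/

namespace OscillatorNetwork

variable {G : Type*} [Fintype G] {N : OscillatorNetwork G} {r : ℕ} {m : G}

namespace IsReducedSolution

variable {z : G → ℝ → ℂ} {q v : G → ℝ → ℝ}

open Classical in
lemma hasDerivAt_grad (h : N.IsReducedSolution z q v) (hA1 : N.A1) (j : G) (t : ℝ) :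
    HasDerivAt (fun t => N.grad (fun i => q i t) j)
      (deriv (deriv (N.U j)) (q j t) * v j t
        - (∑ i, if N.graph.Adj i j then
            deriv (deriv (N.V i j)) (q i t - q j t) * (v i t - v j t) else 0)
        - if j ∈ N.thermo then N.K j * v j t else 0) t := by
  have hd : ∀ {g : ℝ → ℝ}, ContDiff ℝ ∞ g → ∀ x, HasDerivAt (deriv g) (deriv (deriv g) x) x :=
    fun hg x => ((contDiff_infty_iff_deriv.mp
      (contDiff_infty_iff_deriv.mp hg).2).1 x).hasDerivAt
  refine (((hd (hA1.1 j) (q j t)).comp t (h.q_deriv j t)).sub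
    (HasDerivAt.fun_sum fun i _ => ?_)).sub ?_
  · split_ifs with hij
    · exact (hd (hA1.2 i j hij).1 (q i t - q j t)).comp t ((h.q_deriv i t).sub (h.q_deriv j t))
    · exact hasDerivAt_const t 0
  · split_ifs
    · exact (h.q_deriv j t).const_mul _
    · exact hasDerivAt_const t 0

lemma tendsto_grad (h : N.IsReducedSolution z q v) (hA1 : N.A1) (hA2 : N.A2 r) (hA3 : N.A3)
    {j : G} (hj : Tendsto (v j) atTop (𝓝 0)) :
    Tendsto (fun t => N.grad (fun i => q i t) j) atTop (𝓝 0) := by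
  obtain ⟨-, L, -, hL⟩ := (bddLip_grad hA1 (fun j => (h.bddLip hA1 hA2 hA3 j).1) j).neg
  simpa using (tendsto_zero_of_hasDerivAt_add (h.v_deriv j) hj
    (h.tendsto_bathForce hA1 hA2 hA3 j) hL).neg

/-- If all vertices of `S` come to rest, so does the unique neighbour `n` outside `S` of a vertex
`j ∈ S`: the acceleration of `j` and its rate of change tend to zero, hence so does the rate of
change `V'' (q n - q j) (v n - v j)` of the force that `n` exerts on `j`. -/
lemma tendsto_v_of_mem_controlStep (h : N.IsReducedSolution z q v) (hA1 : N.A1) (hA2 : N.A2 r)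
    (hA3 : N.A3) {S : Set G} (hS : ∀ i ∈ S, Tendsto (v i) atTop (𝓝 0)) :
    ∀ n ∈ N.controlStep S, Tendsto (v n) atTop (𝓝 0) := by
  classical
  rintro n (hn | ⟨j, hj, hnS, hadj, huniq⟩)
  · exact hS n hn
  have hq := fun j => (h.bddLip hA1 hA2 hA3 j).1
  have hv := fun j => (h.bddLip hA1 hA2 hA3 j).2
  have hU2 := (contDiff_infty_iff_deriv.mp (contDiff_infty_iff_deriv.mp (hA1.1 j)).2).2
  have hV2 : ∀ i, N.graph.Adj i j → ContDiff ℝ ∞ (deriv (deriv (N.V i j))) := fun i hij =>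
    (contDiff_infty_iff_deriv.mp (contDiff_infty_iff_deriv.mp (hA1.2 i j hij).1).2).2
  -- `F i` is the rate of change of the force that `i` exerts on `j`; the remaining terms in the
  -- derivative of the acceleration are collected in `b`
  let F : G → ℝ → ℝ := fun i t => if N.graph.Adj i j then
    deriv (deriv (N.V i j)) (q i t - q j t) * (v i t - v j t) else 0
  let b : ℝ → ℝ := fun t => (∑ i ∈ Finset.univ.erase n, F i t)
    - deriv (deriv (N.U j)) (q j t) * v j t
    + if j ∈ N.thermo then (N.observable z v (N.κ j) j t).re else 0
  have hφ : ∀ t, HasDerivAt (fun t => -N.grad (fun i => q i t) j + N.bathForce z v j t)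
      (F n t + b t) t := fun t => by
    have hb : HasDerivAt (N.bathForce z v j)
        (if j ∈ N.thermo then (N.observable z v (N.κ j) j t).re - N.K j * v j t else 0) t := by
      split_ifs with hjt
      · exact h.hasDerivAt_bathForce hA2 hjt t
      · have e : N.bathForce z v j = fun _ => 0 := funext fun t => by simp [bathForce, hjt]
        rw [e]; exact hasDerivAt_const t 0
    refine ((h.hasDerivAt_grad hA1 j t).neg.add hb).congr_deriv ?_
    have hs := Finset.add_sum_erase Finset.univ (fun i => F i t) (Finset.mem_univ n)
    change -(_ - (∑ i, F i t) - _) + _ = _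
    rw [← hs]
    simp only [b]
    split_ifs <;> ring
  have hF0 : ∀ i ∈ Finset.univ.erase n, Tendsto (F i) atTop (𝓝 0) := fun i hi => by
    simp only [F]
    split_ifs with hij
    · have hiS : i ∈ S := by
        by_contra hiS
        exact (Finset.mem_erase.mp hi).1 (huniq i hij.symm hiS)
      exact (((hq i).sub (hq j)).comp (hV2 i hij)).tendsto_mul
        (by simpa using (hS i hiS).sub (hS j hj))
    · exact tendsto_const_nhds
  have hb0 : Tendsto b atTop (𝓝 0) := by
    have h1 : Tendsto (fun t => ∑ i ∈ Finset.univ.erase n, F i t) atTop (𝓝 0) := by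
      simpa using tendsto_finsetSum _ hF0
    have h2 := ((hq j).comp hU2).tendsto_mul (hS j hj)
    have h3 : Tendsto (fun t => if j ∈ N.thermo then
        (N.observable z v (N.κ j) j t).re else 0) atTop (𝓝 0) := by
      split_ifs with hjt
      · exact (Complex.continuous_re.tendsto 0).comp
          (h.tendsto_observable hA1 hA2 hA3 hjt (hA2.memLp_κ hjt))
      · exact tendsto_const_nhds
    have h4 := (h1.sub h2).add h3
    simp only [sub_zero, add_zero] at h4
    exact h4
  have hnj : N.graph.Adj n j := hadj.symm
  have hFn : F n = fun t => deriv (deriv (N.V n j)) (q n t - q j t) * (v n t - v j t) :=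
    funext fun t => if_pos hnj
  obtain ⟨-, L, -, hL⟩ : BddLip (F n) := by
    rw [hFn]
    exact (((hq n).sub (hq j)).comp (hV2 n hnj)).mul ((hv n).sub (hv j))
  have hacc : Tendsto (fun t => -N.grad (fun i => q i t) j + N.bathForce z v j t) atTop (𝓝 0) := by
    simpa using (h.tendsto_grad hA1 hA2 hA3 (hS j hj)).neg.add
      (h.tendsto_bathForce hA1 hA2 hA3 j)
  have hlim := tendsto_zero_of_hasDerivAt_add hφ hacc hb0 hL
  rw [hFn] at hlim
  obtain ⟨R, hR⟩ := ((hq n).sub (hq j)).exists_bound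
  obtain ⟨-, L', -, hL'⟩ := (hv n).sub (hv j)
  have hy := tendsto_zero_of_mul_tendsto_zero (hV2 n hnj).continuous (hA1.2 n j hnj).2
    (fun t => (h.q_deriv n t).sub (h.q_deriv j t)) hR hL' hlim
  simpa using hy.add (hS j hj)

lemma tendsto_v (h : N.IsReducedSolution z q v) (hA1 : N.A1) (hA2 : N.A2 r)
    (hA3 : N.A3) (hA5 : N.A5) (j : G) : Tendsto (v j) atTop (𝓝 0) := by
  have hk : ∀ k : ℕ, ∀ i ∈ (N.controlStep)^[k] (N.thermo : Set G), Tendsto (v i) atTop (𝓝 0) := by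
    intro k
    induction k with
    | zero => exact fun i hi => h.tendsto_v_of_mem_thermo hA1 hA2 hA3 hi
    | succ k ih =>
      rw [Function.iterate_succ_apply']
      exact h.tendsto_v_of_mem_controlStep hA1 hA2 hA3 ih
  have hj : j ∈ N.controlled := hA5 ▸ Set.mem_univ j
  obtain ⟨k, hk'⟩ := Set.mem_iUnion.mp hj
  exact hk k j hk'

lemma exists_tendsto_critSet (h : N.IsReducedSolution z q v) (hA1 : N.A1) (hA2 : N.A2 r)
    (hA3 : N.A3) (hA5 : N.A5) (hA6 : N.A6) :
    ∃ p ∈ N.critSet, Tendsto (fun t i => q i t) atTop (𝓝 p) := by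
  obtain ⟨B, C, M, hB, -, -⟩ := h.exists_bounds hA1 hA2 hA3
  have hgrad : Tendsto (fun t => N.grad (fun i => q i t)) atTop (𝓝 0) :=
    tendsto_pi_nhds.mpr fun j => h.tendsto_grad hA1 hA2 hA3 (h.tendsto_v hA1 hA2 hA3 hA5 j)
  obtain ⟨p, hp, hlim⟩ := exists_tendsto_of_isolated_zeros (continuous_grad hA1)
    (fun p hp => (hA6 p ((mem_critSet_iff hA1 p).mpr hp)).mono fun p' hp' h0 =>
      hp' ((mem_critSet_iff hA1 p').mpr h0))
    h.continuous_curve (K := Set.pi Set.univ fun _ => Set.Icc (-B) B)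
    (isCompact_univ_pi fun _ => isCompact_Icc) (fun t i _ => abs_le.mp (hB i t)) hgrad
  exact ⟨p, (mem_critSet_iff hA1 p).mpr hp, hlim⟩

lemma convergesToOrder_grad (hA1 : N.A1) {n : ℕ} (hq : ∀ j, ConvergesToOrder n (q j)) (j : G) :
    ConvergesToOrder n fun t => N.grad (fun i => q i t) j := by
  classical
  refine ((ConvergesToOrder.comp (contDiff_infty_iff_deriv.mp (hA1.1 j)).2 (hq j)).sub
    (ConvergesToOrder.sum _ fun i _ => ?_)).sub ?_
  · split_ifs with hij
    · exact ConvergesToOrder.comp (contDiff_infty_iff_deriv.mp (hA1.2 i j hij).1).2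
        ((hq i).sub (hq j))
    · exact ConvergesToOrder.const n 0
  · split_ifs
    · exact (ConvergesToOrder.const n _).mul (hq j)
    · exact ConvergesToOrder.const n 0

/-- Bootstrap: the motion and the moments `∫ ν^k κ Z` of the amplitudes converge together with
their derivatives, as many as the decay of `κ` permits. -/
lemma convergesToOrder (h : N.IsReducedSolution z q v) (hA1 : N.A1) (hA2 : N.A2 r)
    (hA3 : N.A3) (hA5 : N.A5) (hA6 : N.A6) {n : ℕ} (hn : n ≤ r) :
    (∀ j, ConvergesToOrder n (q j)) ∧ (∀ j, ConvergesToOrder n (v j)) ∧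
      ∀ m ∈ N.thermo, ∀ k, k + n ≤ r →
        ConvergesToOrder n (fun t => (N.observable z v (fun ν => ν ^ k * N.κ m ν) m t).re) ∧
        ConvergesToOrder n (fun t => (N.observable z v (fun ν => ν ^ k * N.κ m ν) m t).im) := by
  obtain ⟨p, -, hp⟩ := h.exists_tendsto_critSet hA1 hA2 hA3 hA5 hA6
  have hqp : ∀ j, Tendsto (q j) atTop (𝓝 (p j)) := fun j => tendsto_pi_nhds.mp hp j
  have hv0 := h.tendsto_v hA1 hA2 hA3 hA5
  have hO : ∀ m ∈ N.thermo, ∀ k ≤ r,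
      Tendsto (N.observable z v (fun ν => ν ^ k * N.κ m ν) m) atTop (𝓝 0) := fun m hm k hk =>
    h.tendsto_observable hA1 hA2 hA3 hm (hA2.memLp_pow_mul hm hk)
  have hre : ∀ m ∈ N.thermo, ∀ k ≤ r, Tendsto
      (fun t => (N.observable z v (fun ν => ν ^ k * N.κ m ν) m t).re) atTop (𝓝 0) :=
    fun m hm k hk => (Complex.continuous_re.tendsto 0).comp (hO m hm k hk)
  have him : ∀ m ∈ N.thermo, ∀ k ≤ r, Tendsto
      (fun t => (N.observable z v (fun ν => ν ^ k * N.κ m ν) m t).im) atTop (𝓝 0) :=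
    fun m hm k hk => (Complex.continuous_im.tendsto 0).comp (hO m hm k hk)
  induction n with
  | zero =>
    refine ⟨fun j => ⟨h.continuous_q j, _, hqp j⟩, fun j => ⟨h.continuous_v j, _, hv0 j⟩,
      fun m hm k hk => ?_⟩
    have hc : Continuous (N.observable z v (fun ν => ν ^ k * N.κ m ν) m) :=
      continuous_integral_mul_bathAmp (hA2.memLp hm) (h.memLp m hm) (h.continuous_v m)
        (hA2.memLp_pow_mul hm hk)
    exact ⟨⟨Complex.continuous_re.comp hc, _, hre m hm k hk⟩,
      ⟨Complex.continuous_im.comp hc, _, him m hm k hk⟩⟩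
  | succ n ih =>
    obtain ⟨ihq, ihv, ihO⟩ := ih (by omega)
    refine ⟨fun j => ⟨⟨_, hqp j⟩, v j, h.q_deriv j, ihv j⟩, fun j => ⟨⟨_, hv0 j⟩, _, h.v_deriv j,
      (convergesToOrder_grad hA1 ihq j).neg.add ?_⟩, fun m hm k hk => ?_⟩
    · by_cases hj : j ∈ N.thermo
      · refine ConvergesToOrder.of_succ ⟨⟨0, h.tendsto_bathForce hA1 hA2 hA3 j⟩, _,
          h.hasDerivAt_bathForce hA2 hj, ?_⟩
        have h0 := (ihO j hj 0 (by omega)).1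
        simp only [pow_zero, one_mul] at h0
        exact h0.sub ((ConvergesToOrder.const n _).mul (ihv j))
      · have e : N.bathForce z v j = fun _ => 0 := funext fun t => by simp [bathForce, hj]
        rw [e]; exact ConvergesToOrder.const n 0
    · have hd := fun t => h.hasDerivAt_observable hA2 hm (hA2.memLp_pow_mul hm (k := k) (by omega))
        (hA2.memLp_pow_mul hm (k := k + 1) (by omega)) (fun ν => by ring) t
      obtain ⟨i1, i2⟩ := ihO m hm (k + 1) (by omega)
      refine ⟨⟨⟨_, hre m hm k (by omega)⟩, _,
          fun t => (Complex.reCLM.hasFDerivAt).comp_hasDerivAt t (hd t), ?_⟩,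
        ⟨⟨_, him m hm k (by omega)⟩, _,
          fun t => (Complex.imCLM.hasFDerivAt).comp_hasDerivAt t (hd t), ?_⟩⟩
      · simpa using i2.neg
      · simpa using i1.sub ((ihv m).mul (ConvergesToOrder.const n
          (∫ ν, formFactor (N.κ m) ν * (ν ^ k * N.κ m ν))))

/-- The energy of the thermostat at `m`, expressed through its amplitude and the position of the
vertex. -/
noncomputable def bathEnergy (N : OscillatorNetwork G) (z : G → ℝ → ℂ) (q v : G → ℝ → ℝ) (m : G)
    (t : ℝ) : ℝ :=
  (1 / 2) * (∫ ν, ‖bathAmp (formFactor (N.κ m)) (z m) (v m) t ν‖ ^ 2)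
    + q m t * (N.observable z v (formFactor (N.κ m)) m t).im + N.K m * (q m t) ^ 2 / 2

/-- The power `q ∫ κ Re Z` transferred to a thermostat. -/
lemma hasDerivAt_bathEnergy (h : N.IsReducedSolution z q v) (hA2 : N.A2 r) (hm : m ∈ N.thermo)
    (t : ℝ) :
    HasDerivAt (bathEnergy N z q v m) (q m t * (N.observable z v (N.κ m) m t).re) t := by
  have h1 := (hasDerivAt_integral_normSq_bathAmp (hA2.memLp hm) (h.memLp m hm)
    (h.continuous_v m) t).const_mul (1 / 2)
  have h2 := h.hasDerivAt_bathForce hA2 hm t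
  have e : N.bathForce z v m = fun t => (N.observable z v (formFactor (N.κ m)) m t).im :=
    funext fun t => by simp [bathForce, hm]
  rw [e] at h2
  have h3 := (((h.q_deriv m t).pow 2).const_mul (N.K m)).div_const 2
  refine ((h1.add ((h.q_deriv m t).mul h2)).add h3).congr_deriv ?_
  change 1 / 2 * (-2 * v m t * (N.observable z v (formFactor (N.κ m)) m t).im) + _ + _ = _
  simp; ring

lemma contDiff_bathEnergy (h : N.IsReducedSolution z q v) (hA1 : N.A1) (hA2 : N.A2 r)
    (hA3 : N.A3) (hA5 : N.A5) (hA6 : N.A6) (hm : m ∈ N.thermo) :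
    ContDiff ℝ ((r + 1 : ℕ) : ℕ∞) (bathEnergy N z q v m) ∧
    ∀ l : ℕ, 1 ≤ l → l ≤ r + 1 →
      Tendsto (iteratedDeriv l (bathEnergy N z q v m)) atTop (𝓝 0) := by
  obtain ⟨hq, -, hO⟩ := h.convergesToOrder hA1 hA2 hA3 hA5 hA6 le_rfl
  have h0 := (hO m hm 0 (by omega)).1
  simp only [pow_zero, one_mul] at h0
  have hp := (hq m).mul h0
  have hd := fun t => h.hasDerivAt_bathEnergy hA2 hm t
  have e : deriv (bathEnergy N z q v m) = fun t => q m t * (N.observable z v (N.κ m) m t).re :=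
    funext fun t => (hd t).deriv
  constructor
  · push_cast
    have : ContDiff ℝ ((r : WithTop ℕ∞) + 1) (bathEnergy N z q v m) := by
      rw [contDiff_succ_iff_deriv]
      exact ⟨fun t => (hd t).differentiableAt, by simp, e ▸ hp.contDiff⟩
    exact_mod_cast this
  · intro l hl hlr
    obtain ⟨l, rfl⟩ : ∃ k, l = k + 1 := ⟨l - 1, by omega⟩
    rw [iteratedDeriv_succ', e]
    rcases Nat.eq_zero_or_pos l with rfl | hl'
    · rw [iteratedDeriv_zero]
      exact (h.bddLip hA1 hA2 hA3 m).1.tendsto_mul ((Complex.continuous_re.tendsto 0).comp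
        (h.tendsto_observable hA1 hA2 hA3 hm (hA2.memLp_κ hm)))
    · exact hp.tendsto_iteratedDeriv hl' (by omega)

/-- By conservation of energy, the thermostats absorb all energy that is not left in the oscillators
at rest. -/
lemma tendsto_sum_bathEnergy (h : N.IsReducedSolution z q v) (hA1 : N.A1) (hA2 : N.A2 r)
    (hA3 : N.A3) (hA5 : N.A5) {p : G → ℝ} (hp : Tendsto (fun t i => q i t) atTop (𝓝 p)) :
    Tendsto (fun t => ∑ m ∈ N.thermo, bathEnergy N z q v m t) atTop
      (𝓝 (∑ j, (v j 0) ^ 2 / 2 + N.Veff (fun i => q i 0)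
        + ∑ m ∈ N.thermo, (1 / 2) * (∫ ν, ‖z m ν‖ ^ 2) - N.Veff p
        + ∑ m ∈ N.thermo, N.K m * (p m) ^ 2 / 2)) := by
  have hqp : ∀ j, Tendsto (q j) atTop (𝓝 (p j)) := fun j => tendsto_pi_nhds.mp hp j
  set H := ∑ j, (v j 0) ^ 2 / 2 + N.Veff (fun i => q i 0)
        + ∑ m ∈ N.thermo, (1 / 2) * (∫ ν, ‖z m ν‖ ^ 2) with hH
  have e : ∀ t, ∑ m ∈ N.thermo, bathEnergy N z q v m t
      = H - ∑ j, (v j t) ^ 2 / 2 - N.Veff (fun i => q i t)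
        + ∑ m ∈ N.thermo, (q m t * (N.observable z v (formFactor (N.κ m)) m t).im
          + N.K m * (q m t) ^ 2 / 2) := fun t => by
    rw [hH, ← h.energy_eq hA1 hA2 t]
    simp only [bathEnergy, Finset.sum_add_distrib]
    ring
  simp_rw [e]
  have h1 : Tendsto (fun t => ∑ j, (v j t) ^ 2 / 2) atTop (𝓝 0) := by
    have := tendsto_finsetSum Finset.univ fun j _ =>
      ((h.tendsto_v hA1 hA2 hA3 hA5 j).pow 2).div_const 2
    simpa using this
  have h2 := ((continuous_Veff hA1).tendsto p).comp hp
  have h3 := tendsto_finsetSum N.thermo fun m hm =>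
    ((h.bddLip hA1 hA2 hA3 m).1.tendsto_mul ((Complex.continuous_im.tendsto 0).comp
      (h.tendsto_observable hA1 hA2 hA3 hm (hA2.memLp hm)))).add
      ((((hqp m).pow 2).const_mul (N.K m)).div_const 2)
  simpa using ((h1.const_sub H).sub h2).add h3

end IsReducedSolution

end OscillatorNetwork

/-! ### Thermostat states as amplitudes, and time reversal -/

section amplitude

variable {κ ξ η : ℝ → ℝ} {Z : ℝ → ℂ} {q : ℝ}

/-- A thermostat state, measured from the equilibrium belonging to the position `q`, as a complex
amplitude. -/
noncomputable def amplitude (κ ξ η : ℝ → ℝ) (q : ℝ) (ν : ℝ) : ℂ :=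
  η ν + Complex.I * ((ν * ξ ν - formFactor κ ν * q : ℝ) : ℂ)

lemma memLp_amplitude (hf : MemLp (formFactor κ) 2) (h : FiniteThermostatEnergy ξ η) :
    MemLp (amplitude κ ξ η q) 2 := by
  obtain ⟨hξ, hη, hint⟩ := h
  have hνξ : AEStronglyMeasurable (fun ν => ν * ξ ν) volume :=
    continuous_id.aestronglyMeasurable.mul hξ
  have h1 : MemLp η 2 := (memLp_two_iff_integrable_sq hη).mpr <|
    hint.mono' (hη.pow 2) (Eventually.of_forall fun ν => by
      rw [Real.norm_eq_abs, abs_of_nonneg (by positivity)]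
      nlinarith [mul_nonneg (sq_nonneg ν) (sq_nonneg (ξ ν))])
  have h2 : MemLp (fun ν => ν * ξ ν) 2 := (memLp_two_iff_integrable_sq hνξ).mpr <|
    hint.mono' (hνξ.pow 2) (Eventually.of_forall fun ν => by
      rw [Real.norm_eq_abs, abs_of_nonneg (by positivity), mul_pow]
      nlinarith [sq_nonneg (η ν)])
  have h3 : MemLp (fun ν => ((ν * ξ ν - formFactor κ ν * q : ℝ) : ℂ)) 2 :=
    (h2.sub (hf.mul_const q)).ofReal
  have h4 : MemLp (fun ν => (η ν : ℂ)) 2 := h1.ofReal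
  exact h4.add (h3.const_mul Complex.I)

lemma amplitude_eq_iff {ν : ℝ} {w : ℂ} (h : amplitude κ ξ η q ν = w) :
    η ν = w.re ∧ ν * ξ ν = w.im + formFactor κ ν * q := by
  subst h
  simp [amplitude]

lemma finiteThermostatEnergy_of_amplitude (hf : MemLp (formFactor κ) 2) (hZ : MemLp Z 2)
    (e : ∀ᵐ ν, amplitude κ ξ η q ν = Z ν) : FiniteThermostatEnergy ξ η := by
  have hre : MemLp (fun ν => (Z ν).re) 2 := hZ.re
  have him : MemLp (fun ν => (Z ν).im + formFactor κ ν * q) 2 := MemLp.add hZ.im (hf.mul_const q)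
  have hne : ∀ᵐ ν : ℝ, ν ≠ 0 := by simp [ae_iff]
  refine ⟨?_, hre.1.congr ?_, (hre.integrable_sq.add him.integrable_sq).congr ?_⟩
  · refine ((him.1.aemeasurable.div aemeasurable_id).aestronglyMeasurable).congr ?_
    filter_upwards [e, hne] with ν h1 h2
    simp only [Pi.div_apply, id]
    rw [← (amplitude_eq_iff h1).2]
    field_simp
  · filter_upwards [e] with ν h1 using (amplitude_eq_iff h1).1.symm
  · filter_upwards [e] with ν h1
    obtain ⟨h2, h3⟩ := amplitude_eq_iff h1
    simp only [Pi.add_apply]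
    rw [← h2, ← h3, mul_pow]

lemma thermostatEnergy_of_amplitude (hf : MemLp (formFactor κ) 2) (hZ : MemLp Z 2)
    (e : ∀ᵐ ν, amplitude κ ξ η q ν = Z ν) :
    thermostatEnergy ξ η = (1 / 2) * (∫ ν, ‖Z ν‖ ^ 2)
      + q * (∫ ν, (formFactor κ ν : ℂ) * Z ν).im
      + (∫ ν, formFactor κ ν * formFactor κ ν) * q ^ 2 / 2 := by
  have h1 := hZ.integrable_norm_pow two_ne_zero
  have h2 : Integrable fun ν => (formFactor κ ν : ℂ) * Z ν := hf.ofReal.integrable_mul hZ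
  have h3 : Integrable fun ν => formFactor κ ν * formFactor κ ν := hf.integrable_mul hf
  have h4 : (∫ ν, (formFactor κ ν : ℂ) * Z ν).im = ∫ ν, ((formFactor κ ν : ℂ) * Z ν).im :=
    ((Complex.imCLM).integral_comp_comm h2).symm
  have h5 : Integrable fun ν => ((formFactor κ ν : ℂ) * Z ν).im := h2.im
  have h6 : ∫ ν, (η ν ^ 2 + ν ^ 2 * ξ ν ^ 2) = ∫ ν, (‖Z ν‖ ^ 2
      + 2 * q * ((formFactor κ ν : ℂ) * Z ν).im + q ^ 2 * (formFactor κ ν * formFactor κ ν)) := by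
    refine integral_congr_ae ?_
    filter_upwards [e] with ν h7
    obtain ⟨h8, h9⟩ := amplitude_eq_iff h7
    rw [← mul_pow, h8, h9, ← Complex.normSq_eq_norm_sq, Complex.normSq_apply, Complex.im_ofReal_mul]
    ring
  have h7 : Integrable fun ν => ‖Z ν‖ ^ 2 + 2 * q * ((formFactor κ ν : ℂ) * Z ν).im :=
    h1.add (h5.const_mul _)
  rw [thermostatEnergy, h6, integral_add h7 (h3.const_mul _),
    integral_add h1 (h5.const_mul _), integral_const_mul, integral_const_mul, h4]
  ring

/-- The force of a thermostat splits into the linear part `K q` and the response of its amplitude. -/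
lemma integral_coupling_of_amplitude (h0 : κ 0 = 0) (hf : MemLp (formFactor κ) 2) (hZ : MemLp Z 2)
    (e : ∀ᵐ ν, amplitude κ ξ η q ν = Z ν) :
    ∫ ν, κ ν * ξ ν = (∫ ν, (formFactor κ ν : ℂ) * Z ν).im
      + (∫ ν, formFactor κ ν * formFactor κ ν) * q := by
  have h2 : Integrable fun ν => (formFactor κ ν : ℂ) * Z ν := hf.ofReal.integrable_mul hZ
  have h3 : Integrable fun ν => formFactor κ ν * formFactor κ ν := hf.integrable_mul hf
  have h4 : (∫ ν, (formFactor κ ν : ℂ) * Z ν).im = ∫ ν, ((formFactor κ ν : ℂ) * Z ν).im :=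
    ((Complex.imCLM).integral_comp_comm h2).symm
  have h5 : Integrable fun ν => ((formFactor κ ν : ℂ) * Z ν).im := h2.im
  rw [h4, ← integral_mul_const, ← integral_add h5 (h3.mul_const q)]
  refine integral_congr_ae ?_
  filter_upwards [e] with ν h7
  obtain ⟨-, h9⟩ := amplitude_eq_iff h7
  rw [← mul_formFactor h0 ν, Complex.im_ofReal_mul]
  linear_combination formFactor κ ν * h9

end amplitude

namespace OscillatorNetwork

section

variable {G : Type*} {N : OscillatorNetwork G} {r : ℕ} {m : G} {ξ₀ η₀ : G → ℝ → ℝ}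

lemma A4.memLp_amplitude (hA4 : N.A4 ξ₀ η₀) (hA2 : N.A2 r) (hm : m ∈ N.thermo) (a : ℝ) :
    MemLp (amplitude (N.κ m) (ξ₀ m) (η₀ m) a) 2 :=
  _root_.memLp_amplitude (hA2.memLp hm) (hA4 m hm)

lemma A4.neg (hA4 : N.A4 ξ₀ η₀) : N.A4 ξ₀ (fun m ν => -η₀ m ν) := by
  intro m hm
  obtain ⟨h1, h2, h3⟩ := hA4 m hm
  exact ⟨h1, h2.neg, by simpa using h3⟩

end

variable {G : Type*} [Fintype G] {N : OscillatorNetwork G} {r : ℕ} {m : G}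

namespace IsSolution

variable {q₀ v₀ : G → ℝ} {ξ₀ η₀ : G → ℝ → ℝ} {q v : G → ℝ → ℝ} {ξ η : G → ℝ → ℝ → ℝ}

/-- The amplitude of the actual thermostat is the explicit solution of the driven linear system. -/
lemma amplitude_eq_bathAmp (h : N.IsSolution q₀ v₀ ξ₀ η₀ q v ξ η) (hA2 : N.A2 r)
    (hm : m ∈ N.thermo) :
    ∀ᵐ ν, ∀ t, amplitude (N.κ m) (ξ m t) (η m t) (q m t) ν
      = bathAmp (formFactor (N.κ m)) (amplitude (N.κ m) (ξ₀ m) (η₀ m) (q₀ m)) (v m) t ν := by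
  have hv : Continuous (v m) := continuous_iff_continuousAt.mpr fun t => (h.v_deriv m t).continuousAt
  filter_upwards [h.ξ_init m hm, h.η_init m hm, h.ξ_deriv m hm, h.η_deriv m hm] with ν e1 e2 d1 d2
  set f := formFactor (N.κ m) with hf
  set Z := bathAmp f (amplitude (N.κ m) (ξ₀ m) (η₀ m) (q₀ m)) (v m) with hZ
  -- the difference of the two sides solves `W' = iν W` with `W = 0` at the initial time
  set W : ℝ → ℂ := fun t => amplitude (N.κ m) (ξ m t) (η m t) (q m t) ν - Z t ν with hW
  have hWd : ∀ t, HasDerivAt W (Complex.I * ν * W t) t := fun t => by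
    have h1 := (d2 t).ofReal_comp
    have h2 := (((d1 t).const_mul ν).sub ((h.q_deriv m t).const_mul (f ν))).ofReal_comp
    have h3 := (h1.add (h2.const_mul Complex.I)).sub (hasDerivAt_bathAmp (f := f)
      (z := amplitude (N.κ m) (ξ₀ m) (η₀ m) (q₀ m)) hv ν t)
    refine h3.congr_deriv ?_
    have hκ : (ν : ℂ) * f ν = N.κ m ν := by exact_mod_cast hA2.mul_formFactor hm ν
    simp only [hW, amplitude, ← hf, ← hZ]
    push_cast
    linear_combination (-(q m t : ℂ)) * hκ - (ν : ℂ) * (ν * ξ m t ν - f ν * q m t) * Complex.I_sq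
  have hconst : ∀ t, phase (ν * -t) * W t = phase (ν * -0) * W 0 := fun t => by
    have hd : ∀ t, HasDerivAt (fun t => phase (ν * -t) * W t) 0 t := fun t => by
      have h1 := ((hasDerivAt_phase ν (-t)).scomp t (hasDerivAt_neg t)).mul (hWd t)
      refine h1.congr_deriv ?_
      simp only [Function.comp, neg_smul, one_smul]
      ring
    exact is_const_of_deriv_eq_zero (fun t => (hd t).differentiableAt) (fun t => (hd t).deriv) t 0
  have hW0 : W 0 = 0 := by
    simp only [hW, hZ, bathAmp_zero, amplitude, e1, e2, h.q_init m, sub_self]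
  intro t
  have h5 := hconst t
  rw [hW0, mul_zero] at h5
  have h6 : W t = 0 := (mul_eq_zero.mp h5).resolve_left fun h7 => by
    have := norm_phase (ν * -t)
    rw [h7, norm_zero] at this
    exact zero_ne_one this
  exact sub_eq_zero.mp h6

lemma memLp_bathAmp (h : N.IsSolution q₀ v₀ ξ₀ η₀ q v ξ η) (hA2 : N.A2 r) (hA4 : N.A4 ξ₀ η₀)
    (hm : m ∈ N.thermo) (t : ℝ) :
    MemLp (bathAmp (formFactor (N.κ m)) (amplitude (N.κ m) (ξ₀ m) (η₀ m) (q₀ m)) (v m) t) 2 :=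
  _root_.memLp_bathAmp (hA2.memLp hm) (hA4.memLp_amplitude hA2 hm _)
    (continuous_iff_continuousAt.mpr fun t => (h.v_deriv m t).continuousAt) t

lemma isReducedSolution (h : N.IsSolution q₀ v₀ ξ₀ η₀ q v ξ η) (hA2 : N.A2 r)
    (hA4 : N.A4 ξ₀ η₀) :
    N.IsReducedSolution (fun m => amplitude (N.κ m) (ξ₀ m) (η₀ m) (q₀ m)) q v where
  memLp m hm := hA4.memLp_amplitude hA2 hm _
  q_deriv := h.q_deriv
  v_deriv j t := by
    refine (h.v_deriv j t).congr_deriv ?_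
    rw [grad, bathForce]
    by_cases hj : j ∈ N.thermo
    · rw [if_pos hj, if_pos hj, if_pos hj, integral_coupling_of_amplitude
        (((hA2 j hj).2.1 0).mpr rfl) (hA2.memLp hj) (h.memLp_bathAmp hA2 hA4 hj t)
        ((h.amplitude_eq_bathAmp hA2 hj).mono fun ν hν => hν t), ← K_eq_integral_formFactor,
        observable]
      ring
    · rw [if_neg hj, if_neg hj, if_neg hj]
      ring

lemma finiteThermostatEnergy (h : N.IsSolution q₀ v₀ ξ₀ η₀ q v ξ η) (hA2 : N.A2 r)
    (hA4 : N.A4 ξ₀ η₀) (hm : m ∈ N.thermo) (t : ℝ) : FiniteThermostatEnergy (ξ m t) (η m t) :=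
  finiteThermostatEnergy_of_amplitude (hA2.memLp hm) (h.memLp_bathAmp hA2 hA4 hm t)
    ((h.amplitude_eq_bathAmp hA2 hm).mono fun _ hν => hν t)

lemma thermostatEnergy_eq (h : N.IsSolution q₀ v₀ ξ₀ η₀ q v ξ η) (hA2 : N.A2 r)
    (hA4 : N.A4 ξ₀ η₀) (hm : m ∈ N.thermo) :
    (fun t => thermostatEnergy (ξ m t) (η m t)) = IsReducedSolution.bathEnergy N
      (fun m => amplitude (N.κ m) (ξ₀ m) (η₀ m) (q₀ m)) q v m := by
  ext t
  rw [thermostatEnergy_of_amplitude (hA2.memLp hm) (h.memLp_bathAmp hA2 hA4 hm t)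
    ((h.amplitude_eq_bathAmp hA2 hm).mono fun _ hν => hν t), ← K_eq_integral_formFactor]
  rfl

/-- Completing the square in the thermostat coordinates turns the total energy into the conserved
quantity of the closed equations of motion. -/
lemma totalEnergy_eq (h : N.IsSolution q₀ v₀ ξ₀ η₀ q v ξ η) (hA2 : N.A2 r)
    (hA4 : N.A4 ξ₀ η₀) :
    N.totalEnergy q₀ v₀ ξ₀ η₀ = ∑ j, (v j 0) ^ 2 / 2 + N.Veff (fun i => q i 0)
      + ∑ m ∈ N.thermo, (1 / 2) *
        ∫ ν, ‖amplitude (N.κ m) (ξ₀ m) (η₀ m) (q₀ m) ν‖ ^ 2 := by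
  have e : ∀ m ∈ N.thermo, thermostatEnergy (ξ₀ m) (η₀ m)
      - q₀ m * ∫ ν, N.κ m ν * ξ₀ m ν
      = (1 / 2) * (∫ ν, ‖amplitude (N.κ m) (ξ₀ m) (η₀ m) (q₀ m) ν‖ ^ 2)
        - N.K m * (q₀ m) ^ 2 / 2 := fun m hm => by
    have hz : MemLp (amplitude (N.κ m) (ξ₀ m) (η₀ m) (q₀ m)) 2 := hA4.memLp_amplitude hA2 hm _
    rw [thermostatEnergy_of_amplitude (hA2.memLp hm) hz (Eventually.of_forall fun _ => rfl),
      integral_coupling_of_amplitude (((hA2 m hm).2.1 0).mpr rfl) (hA2.memLp hm) hz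
        (Eventually.of_forall fun _ => rfl), ← K_eq_integral_formFactor]
    ring
  have e2 := Finset.sum_congr rfl e
  rw [Finset.sum_sub_distrib, Finset.sum_sub_distrib] at e2
  rw [totalEnergy, Veff]
  simp_rw [h.q_init, h.v_init]
  linarith

/-- Time reversal. -/
lemma reverse (h : N.IsSolution q₀ v₀ ξ₀ η₀ q v ξ η) :
    N.IsSolution q₀ (fun j => -v₀ j) ξ₀ (fun m ν => -η₀ m ν) (fun j t => q j (-t))
      (fun j t => -v j (-t)) (fun m t => ξ m (-t)) (fun m t ν => -η m (-t) ν) where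
  q_init j := by simpa using h.q_init j
  v_init j := by simpa using h.v_init j
  ξ_init m hm := by simpa using h.ξ_init m hm
  η_init m hm := by simpa using h.η_init m hm
  q_deriv j t := ((h.q_deriv j (-t)).scomp t (hasDerivAt_neg t)).congr_deriv (neg_one_smul ℝ _)
  integrable m hm t := h.integrable m hm (-t)
  v_deriv j t := by
    refine ((h.v_deriv j (-t)).scomp t (hasDerivAt_neg t)).neg.congr_deriv ?_
    rw [neg_one_smul, neg_neg]
  ξ_deriv m hm := by
    filter_upwards [h.ξ_deriv m hm] with ν hν t
    exact ((hν (-t)).scomp t (hasDerivAt_neg t)).congr_deriv (neg_one_smul ℝ _)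
  η_deriv m hm := by
    filter_upwards [h.η_deriv m hm] with ν hν t
    refine ((hν (-t)).scomp t (hasDerivAt_neg t)).neg.congr_deriv ?_
    rw [neg_one_smul, neg_neg]

end IsSolution

end OscillatorNetwork

lemma thermostatEnergy_neg (ξ η : ℝ → ℝ) :
    thermostatEnergy ξ (fun ν => -η ν) = thermostatEnergy ξ η := by
  simp [thermostatEnergy]

namespace OscillatorNetwork

variable {G : Type*} [Fintype G] {N : OscillatorNetwork G} {r : ℕ} {m : G}
  {q₀ v₀ : G → ℝ} {ξ₀ η₀ : G → ℝ → ℝ} {q v : G → ℝ → ℝ} {ξ η : G → ℝ → ℝ → ℝ}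

lemma IsSolution.exists_tendsto (hA1 : N.A1) (hA2 : N.A2 r) (hA3 : N.A3) (hA4 : N.A4 ξ₀ η₀)
    (hA5 : N.A5) (hA6 : N.A6) (h : N.IsSolution q₀ v₀ ξ₀ η₀ q v ξ η) :
    ∃ p ∈ N.critSet, Tendsto (fun t => fun j => q j t) atTop (𝓝 p) ∧
      Tendsto (fun t => ∑ m ∈ N.thermo, thermostatEnergy (ξ m t) (η m t)) atTop
        (𝓝 (N.totalEnergy q₀ v₀ ξ₀ η₀ - N.Veff p + ∑ m ∈ N.thermo, N.K m * (p m) ^ 2 / 2)) := by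
  have hr := h.isReducedSolution hA2 hA4
  obtain ⟨p, hp, hlim⟩ := hr.exists_tendsto_critSet hA1 hA2 hA3 hA5 hA6
  refine ⟨p, hp, hlim, ?_⟩
  rw [h.totalEnergy_eq hA2 hA4]
  refine (hr.tendsto_sum_bathEnergy hA1 hA2 hA3 hA5 hlim).congr fun t => ?_
  exact Finset.sum_congr rfl fun m hm => (congrFun (h.thermostatEnergy_eq hA2 hA4 hm) t).symm

lemma IsSolution.contDiff_thermostatEnergy (hA1 : N.A1) (hA2 : N.A2 r) (hA3 : N.A3)
    (hA4 : N.A4 ξ₀ η₀) (hA5 : N.A5) (hA6 : N.A6) (h : N.IsSolution q₀ v₀ ξ₀ η₀ q v ξ η)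
    (hm : m ∈ N.thermo) :
    ContDiff ℝ ((r + 1 : ℕ) : ℕ∞) (fun t => thermostatEnergy (ξ m t) (η m t)) ∧
      ∀ l : ℕ, 1 ≤ l → l ≤ r + 1 →
        Tendsto (iteratedDeriv l (fun t => thermostatEnergy (ξ m t) (η m t))) atTop (𝓝 0) := by
  rw [h.thermostatEnergy_eq hA2 hA4 hm]
  exact (h.isReducedSolution hA2 hA4).contDiff_bathEnergy hA1 hA2 hA3 hA5 hA6 hm

end OscillatorNetwork

theorem mainTheorem2 {G : Type*} [Fintype G] (N : OscillatorNetwork G) (r : ℕ)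
    (q₀ v₀ : G → ℝ) (ξ₀ η₀ : G → ℝ → ℝ)
    (hA1 : N.A1) (hA2 : N.A2 r) (hA3 : N.A3) (hA4 : N.A4 ξ₀ η₀) (hA5 : N.A5) (hA6 : N.A6)
    (q v : G → ℝ → ℝ) (ξ η : G → ℝ → ℝ → ℝ)
    (hsol : N.IsSolution q₀ v₀ ξ₀ η₀ q v ξ η) :
    (∀ m ∈ N.thermo, ∀ t, FiniteThermostatEnergy (ξ m t) (η m t)) ∧
    (∃ qplus ∈ N.critSet, Tendsto (fun t => fun j => q j t) atTop (𝓝 qplus) ∧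
      Tendsto (fun t => ∑ m ∈ N.thermo, thermostatEnergy (ξ m t) (η m t)) atTop
        (𝓝 (N.totalEnergy q₀ v₀ ξ₀ η₀ - N.Veff qplus
          + ∑ m ∈ N.thermo, N.K m * (qplus m) ^ 2 / 2))) ∧
    (∃ qminus ∈ N.critSet, Tendsto (fun t => fun j => q j t) atBot (𝓝 qminus) ∧
      Tendsto (fun t => ∑ m ∈ N.thermo, thermostatEnergy (ξ m t) (η m t)) atBot
        (𝓝 (N.totalEnergy q₀ v₀ ξ₀ η₀ - N.Veff qminus
          + ∑ m ∈ N.thermo, N.K m * (qminus m) ^ 2 / 2))) ∧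
    (∀ m ∈ N.thermo,
      ContDiff ℝ ((r + 1 : ℕ) : ℕ∞) (fun t => thermostatEnergy (ξ m t) (η m t)) ∧
      ∀ l : ℕ, 1 ≤ l → l ≤ r + 1 →
        Tendsto (iteratedDeriv l (fun t => thermostatEnergy (ξ m t) (η m t))) atTop (𝓝 0) ∧
        Tendsto (iteratedDeriv l (fun t => thermostatEnergy (ξ m t) (η m t))) atBot (𝓝 0)) := by
  have hrev := hsol.reverse
  have hneg : Tendsto (fun t : ℝ => -t) atBot atTop := tendsto_neg_atBot_atTop
  have hE : N.totalEnergy q₀ (fun j => -v₀ j) ξ₀ (fun m ν => -η₀ m ν)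
      = N.totalEnergy q₀ v₀ ξ₀ η₀ := by
    simp [OscillatorNetwork.totalEnergy, thermostatEnergy_neg]
  refine ⟨fun m hm t => hsol.finiteThermostatEnergy hA2 hA4 hm t,
    hsol.exists_tendsto hA1 hA2 hA3 hA4 hA5 hA6, ?_, fun m hm => ?_⟩
  · obtain ⟨p, hp, h1, h2⟩ := hrev.exists_tendsto hA1 hA2 hA3 hA4.neg hA5 hA6
    refine ⟨p, hp, ?_, ?_⟩
    · simpa [Function.comp_def] using h1.comp hneg
    · rw [hE] at h2
      simpa [Function.comp_def, thermostatEnergy_neg] using h2.comp hneg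
  · obtain ⟨h1, h2⟩ := hsol.contDiff_thermostatEnergy hA1 hA2 hA3 hA4 hA5 hA6 hm
    obtain ⟨-, h3⟩ := hrev.contDiff_thermostatEnergy hA1 hA2 hA3 hA4.neg hA5 hA6 hm
    refine ⟨h1, fun l hl hlr => ⟨h2 l hl hlr, ?_⟩⟩
    have h4 := (h3 l hl hlr).comp hneg
    simp only [thermostatEnergy_neg] at h4
    have h5 : ∀ t, iteratedDeriv l (fun t => thermostatEnergy (ξ m (-t)) (η m (-t))) (-t)
        = (-1 : ℝ) ^ l • iteratedDeriv l (fun t => thermostatEnergy (ξ m t) (η m t)) t := fun t => by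
      have := iteratedDeriv_comp_neg l (fun t => thermostatEnergy (ξ m t) (η m t)) (-t)
      rwa [neg_neg] at this
    have h6 := h4.const_smul ((-1 : ℝ) ^ l)
    rw [smul_zero] at h6
    refine h6.congr fun t => ?_
    simp only [Function.comp]
    rw [h5, smul_smul, ← mul_pow]
    simp
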